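/- Let $F\in\mathbb{C}[x_0,\dots,x_n]$ be homogeneous of degree $d\ge 1$, and let $X=V(g_1,\dots,g_k)\subseteq\mathbb{P}^n$ be an irreducible closed subvariety of codimension $c$ whose homogeneous (prime) ideal is $I(X)=(g_1,\dots,g_k)$, with $g_1,\dots,g_k$ homogeneous. Assume that $X$ is smooth at each of its points outside $V(F)$. For $\eta\in\mathbb{C}^{n+1}$ write $\eta(x)=\sum_j\eta_jx_j$. Let $C_X^\circ=\{x\in\mathbb{C}^{n+1} : g_1(x)=\dots=g_k(x)=0,\ F(x)\ne 0\}$ and $\ell_{F,\eta}=\log F-\eta$. The scheme of critical points of $\ell_{F,\eta}|_{C_X^\circ}$ is $\mathrm{Spec}\big(\mathbb{C}[x_0,\dots,x_n,1/F]/(I_{c+1}(A(x,\eta))+I(X))\big)$, where $A(x,\eta)$ is the matrix with rows $\frac{\nabla F}{F}-\eta,\nabla g_1,\dots,\nabla g_k$ and $I_{c+1}(A)$ is the ideal generated by its $(c+1)\times(c+1)$ minors; the critical points are the $\mathbb{C}$-points of this scheme. Let $f_{F,\eta}=d^d\,F/\eta^d$, viewed as a rational function on $X$, and let $D_{F,\eta}=\mathrm{Supp}(\mathrm{div}(f_{F,\eta}))$,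 the set of points $p\in X$ at which $f_{F,\eta}$ is not a unit of $\mathcal{O}_{X,p}$. The critical points of $\log f_{F,\eta}$ on $X\setminus D_{F,\eta}$ are the points at which $d\log f_{F,\eta}$, a section of the cotangent sheaf of $X\setminus D_{F,\eta}$, vanishes. Then there is a nonempty Zariski open set of $\eta\in\mathbb{C}^{n+1}$ on which the scheme of critical points of $\ell_{F,\eta}|_{C_X^\circ}$ is reduced (possibly empty) and the number of its points is finite and does not depend on $\eta$. This number is denoted $\mathrm{MLD}_X(F)$. Moreover, for generic $\eta$, $$\#\{\text{critical points of }\log f_{F,\eta}\text{ on }X\setminus D_{F,\eta}\}=\mathrm{MLD}_X(F).$$ -/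

import Mathlib

open MvPolynomial

namespace MLDeg

noncomputable section

/-- The polynomial ring `ℂ[x₀, …, xₙ]`. -/
abbrev Poly (n : ℕ) : Type := MvPolynomial (Fin (n + 1)) ℂ

/-- A property of `η ∈ ℂⁿ⁺¹` holds for generic `η` if it holds on a nonempty Zariski open subset,
equivalently on the complement of the zero locus of one nonzero polynomial. -/
def Generic {n : ℕ} (P : (Fin (n + 1) → ℂ) → Prop) : Prop :=
  ∃ h : Poly n, h ≠ 0 ∧ ∀ η : Fin (n + 1) → ℂ, eval η h ≠ 0 → P η

/-- The linear form `η(x) = η₀ x₀ + ⋯ + ηₙ xₙ`. -/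
def linForm {n : ℕ} (η : Fin (n + 1) → ℂ) : Poly n :=
  ∑ j, C (η j) * X j

/-- The ideal `(g₁, …, g_k)`. -/
abbrev idealOf {n k : ℕ} (g : Fin k → Poly n) : Ideal (Poly n) :=
  Ideal.span (Set.range g)

/-- The projective zero set `V(g₁, …, g_k) ⊆ ℙⁿ` of homogeneous polynomials. -/
def projZeros {n k : ℕ} (g : Fin k → Poly n) :
    Set (Projectivization ℂ (Fin (n + 1) → ℂ)) :=
  {p | ∀ i, eval p.rep (g i) = 0}

/-- The codimension of `X = V(g₁, …, g_k)` in `ℙⁿ`, namely the height of its ideal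
(which is finite, the polynomial ring being Noetherian). -/
def codim {n k : ℕ} (g : Fin k → Poly n) : ℕ :=
  (idealOf g).height.toNat

/-- `X = V(g₁, …, g_k)`, with homogeneous ideal `I(X) = (g₁, …, g_k)`, is smooth at `p`: the
Jacobian matrix of `g₁, …, g_k` has rank `codim X` there. -/
def IsSmoothAt {n k : ℕ} (g : Fin k → Poly n)
    (p : Projectivization ℂ (Fin (n + 1) → ℂ)) : Prop :=
  (Matrix.of fun (i : Fin k) (j : Fin (n + 1)) => eval p.rep (pderiv j (g i))).rank = codim g

/-! ### Critical points of `log F - η` on the part `F ≠ 0` of the affine cone -/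

/-- The ideal `I_r(M)` generated by the `r × r` minors of `M`. (A repeated row or column gives
the minor `0`, and the order of rows and columns only affects signs.) -/
def minorIdeal {R : Type*} [CommRing R] {a b : ℕ} (r : ℕ) (M : Matrix (Fin a) (Fin b) R) :
    Ideal R :=
  Ideal.span (Set.range fun s : (Fin r → Fin a) × (Fin r → Fin b) => (M.submatrix s.1 s.2).det)

/-- The `(k+1) × (n+1)` matrix `A(x, η)` over `ℂ[x₀, …, xₙ, 1/F]`, with rows
`∇F / F - η, ∇g₁, …, ∇g_k`. -/
def matrixA {n k : ℕ} (F : Poly n) (g : Fin k → Poly n) (η : Fin (n + 1) → ℂ) :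
    Matrix (Fin (k + 1)) (Fin (n + 1)) (Localization.Away F) :=
  Matrix.of fun i j =>
    (Fin.cons
      (algebraMap (Poly n) (Localization.Away F) (pderiv j F) * IsLocalization.Away.invSelf F
        - algebraMap (Poly n) (Localization.Away F) (C (η j)))
      (fun l : Fin k => algebraMap (Poly n) (Localization.Away F) (pderiv j (g l))) :
      Fin (k + 1) → Localization.Away F) i

/-- The ideal `I_{c+1}(A(x, η)) + I(X)` of `ℂ[x₀, …, xₙ, 1/F]`, `c = codim X`. -/
def critIdeal {n k : ℕ} (F : Poly n) (g : Fin k → Poly n) (η : Fin (n + 1) → ℂ) :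
    Ideal (Localization.Away F) :=
  minorIdeal (codim g + 1) (matrixA F g η) ⊔
    (idealOf g).map (algebraMap (Poly n) (Localization.Away F))

/-- The coordinate ring of the (affine) scheme of critical points of `log F - η` on the part
`F ≠ 0` of the affine cone over `X`. -/
abbrev CritRing {n k : ℕ} (F : Poly n) (g : Fin k → Poly n) (η : Fin (n + 1) → ℂ) : Type :=
  Localization.Away F ⧸ critIdeal F g η

/-- The set of critical points of `log F - η` on the part `F ≠ 0` of the affine cone over `X`:
the `ℂ`-points of the scheme of critical points, in the coordinates of `ℂⁿ⁺¹`. -/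
def coneCritPoints {n k : ℕ} (F : Poly n) (g : Fin k → Poly n) (η : Fin (n + 1) → ℂ) :
    Set (Fin (n + 1) → ℂ) :=
  {x | ∃ φ : CritRing F g η →ₐ[ℂ] ℂ, ∀ j,
    φ (Ideal.Quotient.mk (critIdeal F g η)
      (algebraMap (Poly n) (Localization.Away F) (X j))) = x j}

/-- The maximum likelihood degree of `F` on `X`: the number of critical points of `log F - η` on
the part `F ≠ 0` of the affine cone over `X`, for generic `η`. (At most one number `N` has the
displayed property, since two nonempty Zariski open sets meet.) -/
def mlDegree {n k : ℕ} (F : Poly n) (g : Fin k → Poly n) : ℕ :=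
  sInf {N : ℕ | Generic fun η => (coneCritPoints F g η).encard = N}

/-! ### Critical points of `log f` on `X ∖ D` -/

theorem eval_eq_zero_of_mem {n k : ℕ} (g : Fin k → Poly n)
    {p : Projectivization ℂ (Fin (n + 1) → ℂ)} (hp : p ∈ projZeros g) {a : Poly n} (ha : a ∈ idealOf g) : eval p.rep a = 0 := by
  have : idealOf g ≤ RingHom.ker (eval p.rep) := by
    rw [Ideal.span_le]
    rintro _ ⟨i, rfl⟩
    exact hp i
  exact this ha

/-- For a unit `u` of a local `ℂ`-algebra `(O, 𝔪)`, the differential `d log u = u⁻¹ du ∈ Ω_{O/ℂ}`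
vanishes at the closed point, that is, lies in `𝔪 Ω_{O/ℂ}`. -/
def DLogVanishes (O : Type*) [CommRing O] [IsLocalRing O] [Algebra ℂ O] (u : Oˣ) : Prop :=
  ((u⁻¹ : Oˣ) : O) • KaehlerDifferential.D ℂ O (u : O) ∈
    IsLocalRing.maximalIdeal O • (⊤ : Submodule O (KaehlerDifferential ℂ O))

section Variety

variable {n k : ℕ} (g : Fin k → Poly n) [hI : (idealOf g).IsPrime]

/-- The fraction field of the homogeneous coordinate ring `ℂ[x₀, …, xₙ] / I(X)`. The function
field of `X` is its subfield of quotients of homogeneous elements of equal degree. -/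
abbrev ConeField : Type := FractionRing (Poly n ⧸ idealOf g)

/-- The class of a polynomial in the fraction field of the homogeneous coordinate ring. -/
def toField : Poly n →+* ConeField g :=
  (algebraMap (Poly n ⧸ idealOf g) (ConeField g)).comp (Ideal.Quotient.mk (idealOf g))

theorem toField_ne_zero {p : Projectivization ℂ (Fin (n + 1) → ℂ)} (hp : p ∈ projZeros g)
    {b : Poly n} (hb : eval p.rep b ≠ 0) : toField g b ≠ 0 := by
  intro h
  have h2 : Ideal.Quotient.mk (idealOf g) b = 0 :=
    (IsFractionRing.injective (Poly n ⧸ idealOf g) (ConeField g)) (by simpa [toField] using h)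
  exact hb (eval_eq_zero_of_mem g hp (Ideal.Quotient.eq_zero_iff_mem.mp h2))

/-- The local ring `𝒪_{X,p}`: the quotients `a / b` of homogeneous elements of equal degree of the
homogeneous coordinate ring of `X` with `b(p) ≠ 0`. -/
def localRing (p : projZeros g) : Subalgebra ℂ (ConeField g) where
  carrier := {z | ∃ (m : ℕ) (a b : Poly n), a.IsHomogeneous m ∧ b.IsHomogeneous m ∧
    eval p.1.rep b ≠ 0 ∧ z = toField g a / toField g b}
  mul_mem' := by
    rintro _ _ ⟨m, a, b, ha, hb, hp, rfl⟩ ⟨m', a', b', ha', hb', hp', rfl⟩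
    refine ⟨m + m', a * a', b * b', ha.mul ha', hb.mul hb', by simp [hp, hp'], ?_⟩
    rw [map_mul, map_mul, div_mul_div_comm]
  add_mem' := by
    rintro _ _ ⟨m, a, b, ha, hb, hp, rfl⟩ ⟨m', a', b', ha', hb', hp', rfl⟩
    refine ⟨m + m', a * b' + b * a', b * b', (ha.mul hb').add (hb.mul ha'), hb.mul hb',
      by simp [hp, hp'], ?_⟩
    rw [map_add, map_mul, map_mul, map_mul,
      div_add_div _ _ (toField_ne_zero g p.2 hp) (toField_ne_zero g p.2 hp')]
  algebraMap_mem' r := by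
    refine ⟨0, C r, 1, isHomogeneous_C _ r, isHomogeneous_one _ _, by simp, ?_⟩
    rw [map_one, div_one]
    rfl

theorem isUnit_localRing {p : projZeros g} {m : ℕ} {a b : Poly n} (ha : a.IsHomogeneous m)
    (hb : b.IsHomogeneous m) (hpa : eval p.1.rep a ≠ 0) (hpb : eval p.1.rep b ≠ 0)
    {z : localRing g p} (hz : (z : ConeField g) = toField g a / toField g b) : IsUnit z := by
  refine IsUnit.of_mul_eq_one (⟨toField g b / toField g a, m, b, a, hb, ha, hpa, rfl⟩) ?_
  apply Subtype.ext
  have h1 := toField_ne_zero g p.2 hpa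
  have h2 := toField_ne_zero g p.2 hpb
  simp only [MulMemClass.coe_mul, hz, OneMemClass.coe_one]
  field_simp

instance (p : projZeros g) : IsLocalRing (localRing g p) := by
  refine IsLocalRing.of_isUnit_or_isUnit_one_sub_self fun z => ?_
  obtain ⟨m, a, b, ha, hb, hpb, hz⟩ := z.2
  by_cases hpa : eval p.1.rep a = 0
  · right
    refine isUnit_localRing g (a := b - a) (hb.sub ha) hb (by simpa [hpa] using hpb) hpb ?_
    have h2 := toField_ne_zero g p.2 hpb
    simp only [AddSubgroupClass.coe_sub, OneMemClass.coe_one, hz, map_sub]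
    field_simp
  · exact Or.inl (isUnit_localRing g ha hb hpa hpb hz)

/-- The rational function `f_{F,η} = d ^ d * F / η(x) ^ d` on `X`, where `F` is homogeneous of
degree `d` and `η(x)` does not vanish identically on `X`. -/
def ratFun (F : Poly n) (d : ℕ) (η : Fin (n + 1) → ℂ) : ConeField g :=
  toField g (C ((d : ℂ) ^ d) * F) / toField g (linForm η ^ d)

/-- The support of the (Cartier) divisor `div f` of a rational function `f` on `X`: the set of
points `p` of `X` at which `f` is not a unit of the local ring `𝒪_{X,p}`. -/
def suppDiv (f : ConeField g) : Set (projZeros g) :=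
  {p | ¬ ∃ u : (localRing g p)ˣ, ((u : localRing g p) : ConeField g) = f}

/-- The set of critical points of `log f` on `X ∖ Supp (div f)`: the points at which the section
`d log f = f⁻¹ df` of the cotangent sheaf vanishes. -/
def logCritPoints (f : ConeField g) : Set (projZeros g) :=
  {p | ∃ u : (localRing g p)ˣ, ((u : localRing g p) : ConeField g) = f ∧ p ∉ suppDiv g f ∧
    DLogVanishes (localRing g p) u}

end Variety

end

end MLDeg

/-!
The critical points on the cone form the fibres of an incidence variety over the space of the
vectors `η`. Smoothness of `X` outside `V(F)` means that the Jacobian matrix of the `g i` has rank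
exactly `c = codim X` along `{g = 0, F ≠ 0}` (`rank_jacobian_eval`). Hence, over
`R = ℂ[x, 1/F]`, the ideal generated in `R[η]` by `I(X)` and by the `(c + 1) × (c + 1)` minors of
the matrix with rows `∇F / F - η, ∇g₁, …, ∇g_k` cuts out an affine bundle of rank `c` over
the part `F ≠ 0` of the cone. Its quotient `B` is therefore a domain (`incidenceIdeal_isPrime`):
locally, where a `c × c` minor is invertible, the equations solve for the remaining coordinates of
`η`, so that the ideal is the kernel of the parametrization `η = ∇F / F + ∑ l, Y l • ∇g l`. Its
transcendence degree is at most `(n + 1 - c) + c = n + 1` (`exists_hom_ker_eq_incidenceIdeal`,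
`exists_trdeg_coneField`); the bound `n + 1 - c` for the cone holds because the `dx j` span the
differentials of its function field and the `c` independent rows of the Jacobian matrix are relations
between them (`trdeg_add_rank_le`).

If `ℂ[η] → B` is not injective, the generic fibre is empty. Otherwise `B` is algebraic over `ℂ[η]`,
and a primitive element with separable minimal polynomial shows that over a nonempty open set the
fibres are reduced with a constant number of points (`exists_generic_fibre_card`). Specializing
`B` at `η` gives `CritRing F g η`, whence `exists_generic_card`.

For the comparison with `X`, a point `x` of the cone is critical if and only if `∇F / F - η` at `x`
is a combination of the rows of the Jacobian matrix (`mem_coneCritPoints_iff`). Euler's formula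
then gives `η(x) = d` (`IsNormal.linForm_eq`), so that each line through the origin contains at most
one critical point. On the other side `d log f` vanishes at a point of `X` represented by `x` if and
only if `∇F / F - d η / η(x)` is such a combination: tangent vectors, viewed as homomorphisms to the
dual numbers, give one direction (`isNormal_of_dLogVanishes`), and the relations `∑ j, ∂ⱼ g l dyⱼ = 0`
between the differentials of affine coordinates give the other (`dLogVanishes_of_isNormal`). It
remains to see that `f` is a unit only where `F` and `η` are both nonzero. A generic `η` vanishes
identically on no component of `X ∩ V(F)` (`generic_linForm_notMem`), which rules out that
a common zero cancels in the quotient `F / η ^ d` (`eval_ne_zero_of_unit`).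
-/

namespace MLDeg

/-! ### Minors -/

noncomputable section

/-- If all maximal minors of a `k × r` matrix `J` vanish, then so does the determinant of every
`C * J`: it is a linear combination of these minors. -/
theorem det_mul_eq_zero_of_minors {R : Type*} [CommRing R] {r k : ℕ}
    (C : Matrix (Fin r) (Fin k) R) (J : Matrix (Fin k) (Fin r) R)
    (h : ∀ s : Fin r → Fin k, (J.submatrix s id).det = 0) : (C * J).det = 0 := by
  have e : C * J = fun i => ∑ l, C i l • J l := by
    ext i j
    simp [Matrix.mul_apply, Finset.sum_apply]
  have := (Matrix.detRowAlternating (R := R) (n := Fin r)).toMultilinearMap.map_sum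
    (fun i l => C i l • J l)
  have h2 : (C * J).det = Matrix.detRowAlternating (fun i => ∑ l, C i l • J l) := by
    rw [e]; rfl
  rw [h2]
  refine this.trans (Finset.sum_eq_zero fun s _ => ?_)
  rw [MultilinearMap.map_smul_univ]
  have := h s
  change _ • Matrix.det (J.submatrix s id) = 0
  rw [this, smul_zero]

/-- Putting the vector `w` on top of the matrix `G`. -/
abbrev consRow {R : Type*} {k m : ℕ} (w : Fin m → R) (G : Matrix (Fin k) (Fin m) R) :
    Matrix (Fin (k + 1)) (Fin m) R :=
  Matrix.of fun i j => (Fin.cons (w j) (fun l => G l j) : Fin (k + 1) → R) i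

/-- The coefficient of `w (t i)` in the expansion, along the row `w`, of the minor of
`consRow w G` with rows `w, s` and columns `j, t`. -/
def laplaceCoeff {R : Type*} [CommRing R] {k m c : ℕ} (G : Matrix (Fin k) (Fin m) R)
    (s : Fin c → Fin k) (t : Fin c → Fin m) (j : Fin m) (i : Fin c) : R :=
  (-1) ^ ((i : ℕ) + 1) *
    (G.submatrix s fun l => (Fin.cons j t : Fin (c + 1) → Fin m) (i.succ.succAbove l)).det

/-- The Laplace expansion along the row `w`; the entries of the other rows come from a ring `R` over
which `w` need not be defined. -/
theorem det_consRow_submatrix {R S : Type*} [CommRing R] [CommRing S] (f : R →+* S) {k m c : ℕ}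
    (G : Matrix (Fin k) (Fin m) R) (w : Fin m → S)
    (s : Fin c → Fin k) (t : Fin c → Fin m) (j : Fin m) :
    ((consRow w (G.map f)).submatrix (Fin.cons 0 fun i => (s i).succ : Fin (c + 1) → Fin (k + 1))
      (Fin.cons j t : Fin (c + 1) → Fin m)).det =
      w j * f (G.submatrix s t).det + ∑ i, f (laplaceCoeff G s t j i) * w (t i) := by
  rw [Matrix.det_succ_row_zero, Fin.sum_univ_succ]
  congr 1
  · simp only [Fin.val_zero, pow_zero, one_mul, Matrix.submatrix_apply, Fin.cons_zero]
    rw [RingHom.map_det]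
    congr 2
  · refine Finset.sum_congr rfl fun i _ => ?_
    rw [laplaceCoeff, map_mul, RingHom.map_det, map_pow, map_neg, map_one, Fin.val_succ,
      mul_right_comm]
    congr 3

/-- A matrix over a field of rank at least `c` has a nonzero `c × c` minor. -/
theorem exists_minor_ne_zero {K : Type*} [Field K] {a b c : ℕ} (M : Matrix (Fin a) (Fin b) K)
    (h : c ≤ M.rank) : ∃ (s : Fin c → Fin a) (t : Fin c → Fin b), (M.submatrix s t).det ≠ 0 := by
  have key : ∀ {a b : ℕ} (M : Matrix (Fin a) (Fin b) K), c ≤ M.rank →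
      ∃ s : Fin c → Fin a, (M.submatrix s id).rank = c := by
    intro a b M h
    rw [Matrix.rank_eq_finrank_span_row] at h
    obtain ⟨f, hf, -, hli⟩ := Submodule.exists_fun_fin_finrank_span_eq K (Set.range M.row)
    choose q hq using hf
    refine ⟨fun i => q (Fin.castLE h i), ?_⟩
    have : LinearIndependent K (M.submatrix (fun i => q (Fin.castLE h i)) id).row := by
      have h2 := hli.comp (Fin.castLE h) (Fin.castLE_injective h)
      have e : (M.submatrix (fun i => q (Fin.castLE h i)) id).row = f ∘ Fin.castLE h :=
        funext fun i => hq (Fin.castLE h i)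
      rw [e]
      exact h2
    simpa using this.rank_matrix
  obtain ⟨s, hs⟩ := key M h
  obtain ⟨t, ht⟩ := key (M.submatrix s id).transpose (by rw [Matrix.rank_transpose, hs])
  refine ⟨s, t, fun h0 => ?_⟩
  have h1 : (M.submatrix s t).rank = c := by
    rw [← Matrix.rank_transpose]; exact ht
  have h2 : Function.Surjective (M.submatrix s t).mulVecLin := by
    rw [← LinearMap.range_eq_top]
    apply Submodule.eq_top_of_finrank_eq
    rw [← Matrix.rank, h1]; simp
  have h3 : IsUnit (M.submatrix s t) := Matrix.mulVec_surjective_iff_isUnit.mp h2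
  rw [Matrix.isUnit_iff_isUnit_det, h0] at h3
  exact not_isUnit_zero h3

theorem le_rank_of_minor_ne_zero {K : Type*} [Field K] {a b c : ℕ} (M : Matrix (Fin a) (Fin b) K)
    (s : Fin c → Fin a) (t : Fin c → Fin b) (h : (M.submatrix s t).det ≠ 0) : c ≤ M.rank := by
  have h1 : (M.submatrix s t).rank = c := by
    have := Matrix.rank_of_isUnit (M.submatrix s t)
      ((Matrix.isUnit_iff_isUnit_det _).2 (isUnit_iff_ne_zero.2 h))
    simpa using this
  rw [← h1]
  exact Matrix.rank_submatrix_le M s t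

end

/-! ### Generic fibres of generically finite maps -/

noncomputable section

/-- A generically finite extension of domains in characteristic zero is generically generated by
one integral element. -/
theorem exists_integral_generator (A B : Type*) [CommRing A] [IsDomain A] [CharZero A]
    [CommRing B] [IsDomain B] [Algebra A B] [FaithfulSMul A B] [Algebra.IsAlgebraic A B]
    [Algebra.FiniteType A B] :
    ∃ θ : B, IsIntegral A θ ∧ ∀ b : B, ∃ a : A, a ≠ 0 ∧ a • b ∈ Algebra.adjoin A {θ} := by
  let K := FractionRing A
  let L := FractionRing B
  let : Algebra K L := FractionRing.liftAlgebra A L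
  have : IsScalarTower A K L := FractionRing.isScalarTower_liftAlgebra A L
  have : Algebra.IsAlgebraic A L := (IsFractionRing.isAlgebraic_iff' A B L).mp inferInstance
  have : Algebra.IsAlgebraic K L := (IsFractionRing.comap_isAlgebraic_iff (A := A)).mp inferInstance
  have : Algebra.EssFiniteType B L := Algebra.EssFiniteType.of_isLocalization L (nonZeroDivisors B)
  have : Algebra.EssFiniteType A L := Algebra.EssFiniteType.comp A B L
  have : Algebra.EssFiniteType K L := Algebra.EssFiniteType.of_comp A K L
  have : Module.Finite K L := Algebra.finite_of_essFiniteType_of_isAlgebraic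
  have : CharZero K := charZero_of_injective_algebraMap (IsFractionRing.injective A K)
  obtain ⟨α, hα⟩ := Field.exists_primitive_element K L
  obtain ⟨b, b', hb', rfl⟩ := IsFractionRing.div_surjective (A := B) α
  obtain ⟨c, d, hd, hdc⟩ := Algebra.IsAlgebraic.exists_smul_eq_mul A b (nonZeroDivisors.ne_zero hb')
  obtain ⟨a, ha, hac⟩ := (Algebra.IsAlgebraic.isAlgebraic (R := A) c).exists_integral_multiple
  refine ⟨a • c, hac, fun z => ?_⟩
  have hb0 : algebraMap B L b' ≠ 0 :=
    IsFractionRing.to_map_ne_zero_of_mem_nonZeroDivisors hb'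
  have hdK : algebraMap A K d ≠ 0 := by simpa using hd
  have haK : algebraMap A K a ≠ 0 := by simpa using ha
  have hdL : algebraMap A L d ≠ 0 := by
    rw [IsScalarTower.algebraMap_apply A K L]; simpa using hdK
  have e1 : algebraMap B L b / algebraMap B L b' =
      (algebraMap A K (a * d))⁻¹ • algebraMap B L (a • c) := by
    rw [eq_inv_smul_iff₀ (by rw [map_mul]; exact mul_ne_zero haK hdK), Algebra.smul_def,
      ← IsScalarTower.algebraMap_apply, ← mul_div_assoc, div_eq_iff hb0,
      IsScalarTower.algebraMap_apply A B L, ← map_mul, ← map_mul, map_mul (algebraMap A B),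
      Algebra.smul_def]
    rw [Algebra.smul_def] at hdc
    congr 1
    linear_combination (algebraMap A B a) * hdc
  have htop : IntermediateField.adjoin K {algebraMap B L (a • c)} = ⊤ := by
    rw [eq_top_iff, ← hα, IntermediateField.adjoin_simple_le_iff, e1]
    exact IntermediateField.smul_mem _ (IntermediateField.mem_adjoin_simple_self K _)
  rw [IntermediateField.adjoin_eq_top_iff] at htop
  have hz : algebraMap B L z ∈ Algebra.adjoin K {algebraMap B L (a • c)} := by
    rw [htop]; trivial
  rw [Algebra.adjoin_singleton_eq_range_aeval] at hz
  obtain ⟨p, hp⟩ := hz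
  obtain ⟨r, hr, hr2⟩ := IsLocalization.integerNormalization_spec (nonZeroDivisors A) p
  refine ⟨r, nonZeroDivisors.ne_zero hr, ?_⟩
  rw [Algebra.adjoin_singleton_eq_range_aeval]
  refine ⟨IsLocalization.integerNormalization (nonZeroDivisors A) p, ?_⟩
  apply IsFractionRing.injective B L
  change algebraMap B L (Polynomial.aeval _ _) = _
  rw [← Polynomial.aeval_algebraMap_apply, ← Polynomial.aeval_map_algebraMap K, hr2]
  rw [← algebraMap_smul K r p, map_smul]
  have hp' : Polynomial.aeval (algebraMap B L (a • c)) p = algebraMap B L z := hp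
  rw [hp', Algebra.smul_def, Algebra.smul_def, map_mul, ← IsScalarTower.algebraMap_apply,
    ← IsScalarTower.algebraMap_apply]

/-- A quotient of `k[X]` by an ideal that contains a separable polynomial is reduced. -/
theorem isReduced_of_separable_root {k T : Type*} [Field k] [CommRing T] [Algebra k T] (t : T)
    (hsurj : Function.Surjective (Polynomial.aeval (R := k) t)) (m : Polynomial k)
    (hm : m.Separable) (h0 : Polynomial.aeval t m = 0) : IsReduced T := by
  set I := RingHom.ker (Polynomial.aeval (R := k) t) with hI
  obtain ⟨p, hp⟩ := (IsPrincipalIdealRing.principal I).principal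
  have hpm : p ∣ m := by
    rw [← Ideal.mem_span_singleton, ← Ideal.submodule_span_eq, ← hp]; exact h0
  have hrad : I.IsRadical := by
    have hp' : I = Ideal.span {p} := hp
    rw [hp', ← isRadical_iff_span_singleton]
    exact (hm.squarefree.squarefree_of_dvd hpm).isRadical
  exact (RingHom.ker_isRadical_iff_reduced_of_surjective
    (f := (Polynomial.aeval (R := k) t)) hsurj).mp hrad

/-- A monic irreducible polynomial over an integrally closed domain of characteristic zero is
separable up to a nonzero constant. -/
theorem exists_bezout_derivative {A : Type*} [CommRing A] [IsDomain A] [IsIntegrallyClosed A]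
    [CharZero A] {m : Polynomial A} (hm : m.Monic) (hirr : Irreducible m) :
    ∃ (h : A) (u v : Polynomial A), h ≠ 0 ∧ u * m + v * m.derivative = Polynomial.C h := by
  let K := FractionRing A
  have : CharZero K := charZero_of_injective_algebraMap (IsFractionRing.injective A K)
  have h1 : (m.map (algebraMap A K)).Separable :=
    (hm.irreducible_iff_irreducible_map_fraction_map.mp hirr).separable
  obtain ⟨u, v, huv⟩ := h1
  obtain ⟨r, hr, hu⟩ := IsLocalization.integerNormalization_spec (nonZeroDivisors A) u
  obtain ⟨q, hq, hv⟩ := IsLocalization.integerNormalization_spec (nonZeroDivisors A) v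
  refine ⟨r * q, Polynomial.C q * IsLocalization.integerNormalization (nonZeroDivisors A) u,
    Polynomial.C r * IsLocalization.integerNormalization (nonZeroDivisors A) v,
    mul_ne_zero (nonZeroDivisors.ne_zero hr) (nonZeroDivisors.ne_zero hq), ?_⟩
  apply Polynomial.map_injective _ (IsFractionRing.injective A K)
  rw [← algebraMap_smul K r u, Polynomial.smul_eq_C_mul] at hu
  rw [← algebraMap_smul K q v, Polynomial.smul_eq_C_mul] at hv
  rw [Polynomial.derivative_map] at huv
  simp only [Polynomial.map_add, Polynomial.map_mul, Polynomial.map_C, hu, hv, map_mul]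
  linear_combination (Polynomial.C (algebraMap A K r) * Polynomial.C (algebraMap A K q)) * huv

/-- If every element of the domain `B` is multiplied into the subalgebra `S` by a power of `h`,
then a homomorphism from `S` to a field that does not kill `h` extends to `B`. -/
theorem exists_extend_of_pow_smul_mem {A B F : Type*} [CommRing A] [CommRing B] [IsDomain B]
    [Algebra A B] [FaithfulSMul A B] [Field F] (S : Subalgebra A B) (h : A) (h0 : h ≠ 0)
    (hS : ∀ b : B, ∃ k : ℕ, h ^ k • b ∈ S) (φ : S →+* F) (hφ : φ (algebraMap A S h) ≠ 0) :
    ∃ ψ : B →+* F, ∀ c : S, ψ c = φ c := by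
  let Bh := Localization.Away (algebraMap A B h)
  let x : S := algebraMap A S h
  have hx : algebraMap A B h ≠ 0 := by simpa using h0
  have hinj : Function.Injective (algebraMap B Bh) :=
    IsLocalization.injective Bh (powers_le_nonZeroDivisors_of_noZeroDivisors hx)
  have hloc : IsLocalization.Away x Bh := by
    refine IsLocalization.Away.mk x
      (IsLocalization.Away.algebraMap_isUnit (S := Bh) (algebraMap A B h)) (fun z => ?_)
      (fun a b hab => ⟨0, ?_⟩)
    · obtain ⟨k, b, hb⟩ := IsLocalization.Away.surj (algebraMap A B h) z
      obtain ⟨l, hl⟩ := hS b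
      refine ⟨k + l, ⟨h ^ l • b, hl⟩, ?_⟩
      change z * (algebraMap B Bh (algebraMap A B h)) ^ (k + l) = algebraMap B Bh (h ^ l • b)
      rw [pow_add, ← mul_assoc, hb, Algebra.smul_def, map_mul, map_pow, map_pow, mul_comm]
    · have : (a : B) = b := hinj hab
      rw [Subtype.ext this]
  let ψ : Bh →+* F := IsLocalization.Away.lift x (g := φ) (isUnit_iff_ne_zero.mpr hφ)
  exact ⟨ψ.comp (algebraMap B Bh), fun c =>
    IsLocalization.Away.lift_eq x (isUnit_iff_ne_zero.mpr hφ) c⟩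

/-- Common denominators: if every element of `B` has a nonzero multiple in `S`, then one element
`h` clears the denominators of a finite set of generators, and powers of `h` those of all elements.
The factor `q` leaves room for further conditions on `h`. -/
theorem exists_pow_smul_mem_of_finiteType {A B : Type*} [CommRing A] [IsDomain A] [CommRing B]
    [Algebra A B] [Algebra.FiniteType A B] (S : Subalgebra A B)
    (hS : ∀ b : B, ∃ a : A, a ≠ 0 ∧ a • b ∈ S) :
    ∃ h : A, h ≠ 0 ∧ ∀ q : A, ∀ b : B, ∃ k : ℕ, (h * q) ^ k • b ∈ S := by
  classical
  obtain ⟨s, hs⟩ := (Algebra.FiniteType.out : (⊤ : Subalgebra A B).FG)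
  choose a ha haS using hS
  refine ⟨∏ b ∈ s, a b, Finset.prod_ne_zero_iff.mpr fun b _ => ha b, fun q b => ?_⟩
  have hb : b ∈ Algebra.adjoin A (s : Set B) := by rw [hs]; trivial
  induction hb using Algebra.adjoin_induction with
  | mem b hb =>
    refine ⟨1, ?_⟩
    rw [pow_one, ← Finset.mul_prod_erase s a hb,
      show a b * (∏ x ∈ s.erase b, a x) * q = ((∏ x ∈ s.erase b, a x) * q) * a b by ring, mul_smul]
    exact S.smul_mem (haS b) _
  | algebraMap r => exact ⟨0, by simp⟩
  | add x y _ _ hx hy =>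
    obtain ⟨k, hk⟩ := hx
    obtain ⟨l, hl⟩ := hy
    refine ⟨k + l, ?_⟩
    rw [smul_add]
    refine S.add_mem ?_ ?_
    · rw [pow_add, mul_comm, mul_smul]; exact S.smul_mem hk _
    · rw [pow_add, mul_smul]; exact S.smul_mem hl _
  | mul x y _ _ hx hy =>
    obtain ⟨k, hk⟩ := hx
    obtain ⟨l, hl⟩ := hy
    refine ⟨k + l, ?_⟩
    rw [pow_add, ← smul_mul_smul_comm]
    exact S.mul_mem hk hl

/-- Over a generic point, the fibre of a generically finite dominant map with integral source, to
a normal target in characteristic zero, is reduced, with a constant number of points: birationally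
the source is the zero scheme of a separable monic polynomial over the target. -/
theorem exists_generic_fibre_card {A B k : Type*} [CommRing A] [IsDomain A]
    [IsIntegrallyClosed A] [CharZero A] [CommRing B] [IsDomain B] [Algebra A B] [FaithfulSMul A B]
    [Algebra.IsAlgebraic A B] [Algebra.FiniteType A B] [Field k] [IsAlgClosed k] :
    ∃ (h : A) (N : ℕ), h ≠ 0 ∧ ∀ e : A →+* k, Function.Surjective e → e h ≠ 0 →
      {φ : B →+* k | φ.comp (algebraMap A B) = e}.encard = N ∧
      ∀ {T : Type*} [CommRing T] [Algebra k T] (π : B →+* T), Function.Surjective π →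
        π.comp (algebraMap A B) = (algebraMap k T).comp e → IsReduced T := by
  obtain ⟨θ, hθ, hgen⟩ := exists_integral_generator A B
  have : IsDomain (Algebra.adjoin A {θ}) := inferInstance
  obtain ⟨h₁, u, v, hh₁, huv⟩ := exists_bezout_derivative (minpoly.monic hθ)
    (minpoly.irreducible hθ)
  obtain ⟨h₂, hh₂, hpow⟩ := exists_pow_smul_mem_of_finiteType _ hgen
  set m := minpoly A θ with hm
  refine ⟨h₂ * h₁, m.natDegree, mul_ne_zero hh₂ hh₁, fun e he hne => ?_⟩
  have hmonic : m.Monic := minpoly.monic hθ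
  -- the specialized polynomial stays separable, because `e h₁` is invertible
  have hsep : (m.map e).Separable := by
    refine ⟨Polynomial.C (e h₁)⁻¹ * u.map e, Polynomial.C (e h₁)⁻¹ * v.map e, ?_⟩
    have h3 := congrArg (Polynomial.map e) huv
    simp only [Polynomial.map_add, Polynomial.map_mul, Polynomial.map_C] at h3
    rw [mul_assoc, mul_assoc, ← mul_add, Polynomial.derivative_map, h3, ← Polynomial.C_mul,
      inv_mul_cancel₀ (right_ne_zero_of_mul (by rwa [map_mul] at hne)), Polynomial.C_1]
  constructor
  · have hcard : ((m.map e).rootSet k).encard = m.natDegree := by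
      have h4 := Polynomial.card_rootSet_eq_natDegree (K := k) hsep (IsAlgClosed.splits _)
      rw [hmonic.natDegree_map] at h4
      rw [← h4, Set.encard_eq_coe_toFinset_card, Set.toFinset_card]
    have hroot : ∀ t : k, t ∈ (m.map e).rootSet k ↔ m.eval₂ e t = 0 := by
      intro t
      rw [Polynomial.mem_rootSet, Polynomial.aeval_def, Polynomial.eval₂_map]
      exact and_iff_right (hmonic.map e).ne_zero
    have hφe : ∀ φ : {φ : B →+* k | φ.comp (algebraMap A B) = e}, ∀ a : A,
        φ.1 (algebraMap A B a) = e a := fun φ a => RingHom.congr_fun φ.2 a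
    have hφp : ∀ φ : {φ : B →+* k | φ.comp (algebraMap A B) = e}, ∀ p : Polynomial A,
        φ.1 (Polynomial.aeval θ p) = p.eval₂ e (φ.1 θ) := by
      intro φ p
      rw [Polynomial.aeval_def, Polynomial.hom_eval₂]
      congr 1
      exact φ.2
    rw [← hcard]
    -- the points of the fibre correspond to the roots of the specialized polynomial
    refine Set.encard_congr (Equiv.ofBijective (fun φ => ⟨φ.1 θ, ?_⟩) ⟨?_, ?_⟩)
    · rw [hroot, ← hφp, hm, minpoly.aeval, map_zero]
    · intro φ ψ hφψ
      have h5 : φ.1 θ = ψ.1 θ := congrArg Subtype.val hφψ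
      apply Subtype.ext
      ext b
      obtain ⟨l, hl⟩ := hpow h₁ b
      rw [Algebra.adjoin_singleton_eq_range_aeval] at hl
      obtain ⟨p, hp⟩ := hl
      have hp' : Polynomial.aeval θ p = (h₂ * h₁) ^ l • b := hp
      have h6 : φ.1 (Polynomial.aeval θ p) = ψ.1 (Polynomial.aeval θ p) := by
        rw [hφp, hφp, h5]
      rw [hp', Algebra.smul_def, map_mul φ.1, map_mul ψ.1, hφe, hφe, map_pow] at h6
      exact mul_left_cancel₀ (pow_ne_zero _ hne) h6
    · rintro ⟨t, ht⟩
      rw [hroot] at ht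
      let f : AdjoinRoot m →+* k := AdjoinRoot.lift e t ht
      let φ : Algebra.adjoin A {θ} →+* k := f.comp (minpoly.equivAdjoin hθ).symm.toRingHom
      have hφ : ∀ p : Polynomial A, ∀ hp, φ ⟨Polynomial.aeval θ p, hp⟩ = p.eval₂ e t := by
        intro p hp
        have h7 : (minpoly.equivAdjoin hθ).symm ⟨Polynomial.aeval θ p, hp⟩ = AdjoinRoot.mk m p := by
          rw [AlgEquiv.symm_apply_eq]
          apply Subtype.ext
          rw [minpoly.coe_equivAdjoin]
          change _ = ((AdjoinRoot.Minpoly.toAdjoin A θ (AdjoinRoot.mk (minpoly A θ) p) : _) : B)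
          rw [AdjoinRoot.Minpoly.coe_toAdjoin, AdjoinRoot.liftAlgHom_mk]
          exact (Polynomial.aeval_subalgebra_coe p _ ⟨θ, Algebra.self_mem_adjoin_singleton A θ⟩).symm
        change f ((minpoly.equivAdjoin hθ).symm ⟨Polynomial.aeval θ p, hp⟩) = _
        rw [h7]
        exact AdjoinRoot.lift_mk ht p
      have hφC : ∀ a : A, φ (algebraMap A _ a) = e a := by
        intro a
        have h8 := hφ (Polynomial.C a) (by rw [Polynomial.aeval_C]; exact Subalgebra.algebraMap_mem _ a)
        rw [Polynomial.eval₂_C] at h8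
        rw [← h8]
        congr 1
        exact Subtype.ext (Polynomial.aeval_C (R := A) θ a).symm
      have hφX : φ ⟨θ, Algebra.self_mem_adjoin_singleton A θ⟩ = t := by
        have h8 := hφ Polynomial.X (by
          rw [Polynomial.aeval_X]; exact Algebra.self_mem_adjoin_singleton A θ)
        rw [Polynomial.eval₂_X] at h8
        rw [← h8]
        congr 1
        exact Subtype.ext (Polynomial.aeval_X (R := A) θ).symm
      obtain ⟨ψ, hψ⟩ := exists_extend_of_pow_smul_mem (Algebra.adjoin A {θ}) (h₂ * h₁)
        (mul_ne_zero hh₂ hh₁) (hpow h₁) φ (by rwa [hφC])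
      refine ⟨⟨ψ, ?_⟩, Subtype.ext ?_⟩
      · ext a
        exact (hψ (algebraMap A _ a)).trans (hφC a)
      · exact (hψ ⟨θ, Algebra.self_mem_adjoin_singleton A θ⟩).trans hφX
  · intro T _ _ π hπ hc
    have hmk : ∀ p : Polynomial A, π (Polynomial.aeval θ p) =
        Polynomial.aeval (π θ) (p.map e) := by
      intro p
      rw [Polynomial.aeval_def, Polynomial.hom_eval₂, hc, Polynomial.aeval_def,
        Polynomial.eval₂_map]
    -- `T` is generated over `k` by the image of `θ`, which is a root of `m.map e`
    refine isReduced_of_separable_root (π θ) ?_ (m.map e) hsep ?_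
    · intro t
      obtain ⟨b, rfl⟩ := hπ t
      obtain ⟨l, hl⟩ := hpow h₁ b
      rw [Algebra.adjoin_singleton_eq_range_aeval] at hl
      obtain ⟨p, hp⟩ := hl
      refine ⟨Polynomial.C ((e (h₂ * h₁)) ^ l)⁻¹ * p.map e, ?_⟩
      have hp' : Polynomial.aeval θ p = (h₂ * h₁) ^ l • b := hp
      have hc' : ∀ a, π (algebraMap A B a) = algebraMap k T (e a) := fun a => RingHom.congr_fun hc a
      rw [map_mul, ← hmk, hp', Algebra.smul_def, map_mul π, hc', map_pow e,
        Polynomial.aeval_C, ← mul_assoc, ← map_mul,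
        inv_mul_cancel₀ (pow_ne_zero _ hne), map_one, one_mul]
    · rw [← hmk, hm, minpoly.aeval, map_zero]

end

/-! ### Differentials and transcendence degree -/

noncomputable section

/-- The chain rule for a derivation applied to a polynomial expression. -/
theorem derivation_aeval {k R M σ : Type*} [CommRing k] [CommRing R] [Algebra k R]
    [AddCommGroup M] [Module k M] [Module R M] [IsScalarTower k R M] [Fintype σ]
    (D : Derivation k R M) (x : σ → R) (p : MvPolynomial σ k) :
    D (aeval x p) = ∑ j, aeval x (pderiv j p) • D (x j) := by
  classical
  induction p using MvPolynomial.induction_on with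
  | C a => simp
  | add p q hp hq => simp [hp, hq, add_smul, Finset.sum_add_distrib]
  | mul_X p i hp =>
    simp only [map_mul, aeval_X, Derivation.leibniz, hp, pderiv_X, map_add, smul_eq_mul,
      add_smul, Finset.sum_add_distrib, Finset.smul_sum, mul_smul]
    congr 1
    rw [Finset.sum_eq_single i]
    · simp
    · intro j _ hj
      simp [hj.symm]
    · simp

/-- The Kähler differentials of a field extension in characteristic zero have the differentials
of a transcendence basis as a basis. -/
theorem exists_basis_kaehler {k Q ι : Type*} [Field k] [CharZero k] [Field Q] [Algebra k Q]
    (y : ι → Q) (hy : IsTranscendenceBasis k y) :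
    ∃ b : Module.Basis ι Q (Ω[Q⁄k]), ∀ i, b i = KaehlerDifferential.D k Q (y i) := by
  let P := MvPolynomial ι k
  let K := FractionRing P
  let : Algebra P Q := (aeval y).toRingHom.toAlgebra
  have : IsScalarTower k P Q := IsScalarTower.of_algebraMap_eq fun r => (aeval_C y r).symm
  have hinj : Function.Injective (algebraMap P Q) := hy.1
  have : FaithfulSMul P Q := (faithfulSMul_iff_algebraMap_injective P Q).mpr hinj
  let : Algebra K Q := FractionRing.liftAlgebra P Q
  have : IsScalarTower P K Q := FractionRing.isScalarTower_liftAlgebra P Q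
  have : Algebra.IsAlgebraic P Q := by
    have := hy.isAlgebraic
    refine Algebra.IsAlgebraic.of_ringHom_of_comp_eq (S := Algebra.adjoin k (Set.range y)) (B := Q)
      hy.1.aevalEquiv.toRingHom (RingHom.id Q) hy.1.aevalEquiv.surjective (fun _ _ h => h) ?_
    exact RingHom.ext fun p => hy.1.algebraMap_aevalEquiv p
  have : Algebra.IsAlgebraic K Q := (IsFractionRing.comap_isAlgebraic_iff (A := P)).mp inferInstance
  have : CharZero P := charZero_of_injective_algebraMap (FaithfulSMul.algebraMap_injective k P)
  have : CharZero K := charZero_of_injective_algebraMap (IsFractionRing.injective P K)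
  have : Algebra.FormallyEtale P K := Algebra.FormallyEtale.of_isLocalization (nonZeroDivisors P)
  have : Algebra.FormallyEtale K Q := Algebra.FormallyEtale.of_isSeparable K Q
  have : Algebra.FormallyEtale P Q := Algebra.FormallyEtale.comp P K Q
  refine ⟨((KaehlerDifferential.mvPolynomialBasis k ι).baseChange Q).map
    (KaehlerDifferential.tensorKaehlerEquivOfFormallyEtale k P Q), fun i => ?_⟩
  rw [Module.Basis.map_apply, Module.Basis.baseChange_apply,
    KaehlerDifferential.tensorKaehlerEquivOfFormallyEtale_apply,
    KaehlerDifferential.mapBaseChange_tmul, one_smul,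
    KaehlerDifferential.mvPolynomialBasis_apply, KaehlerDifferential.map_D]
  congr 1
  exact aeval_X y i

/-- If the field `Q` is algebraic over the subalgebra generated by `m` elements `x j`, and these
satisfy polynomial relations with a Jacobian matrix of rank `r`, then the transcendence degree of
`Q` is at most `m - r`: the differentials `dx j` span a space of dimension the transcendence
degree, and the rows of the Jacobian matrix are relations between them. -/
theorem trdeg_add_rank_le {k Q : Type*} [Field k] [CharZero k] [Field Q] [Algebra k Q] {m a : ℕ}
    (x : Fin m → Q) [Algebra.IsAlgebraic (Algebra.adjoin k (Set.range x)) Q]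
    (G : Fin a → MvPolynomial (Fin m) k) (hG : ∀ i, aeval x (G i) = 0) :
    ∃ r : ℕ, Algebra.trdeg k Q = r ∧
      r + (Matrix.of fun (i : Fin a) (j : Fin m) => aeval x (pderiv j (G i))).rank ≤ m := by
  obtain ⟨s, hs, hb⟩ := exists_isTranscendenceBasis_subset (R := k) (Set.range x)
  have hfin : Finite s := (Set.finite_range x).subset hs
  have := Fintype.ofFinite s
  obtain ⟨b, hbD⟩ := exists_basis_kaehler _ hb
  refine ⟨Fintype.card s, ?_, ?_⟩
  · rw [← hb.cardinalMk_eq_trdeg, Cardinal.mk_fintype]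
  · let f : (Fin m → Q) →ₗ[Q] Ω[Q⁄k] :=
      Fintype.linearCombination Q fun j => KaehlerDifferential.D k Q (x j)
    have hsurj : LinearMap.range f = ⊤ := by
      rw [eq_top_iff, ← b.span_eq, Submodule.span_le]
      rintro _ ⟨i, rfl⟩
      obtain ⟨j, hj⟩ := hs i.2
      refine ⟨Pi.single j 1, ?_⟩
      rw [Fintype.linearCombination_apply_single, one_smul, hbD, hj]
    have hker : Submodule.span Q (Set.range
        (Matrix.of fun (i : Fin a) (j : Fin m) => aeval x (pderiv j (G i))).row) ≤
        LinearMap.ker f := by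
      rw [Submodule.span_le]
      rintro _ ⟨i, rfl⟩
      change f _ = 0
      rw [Fintype.linearCombination_apply]
      change ∑ j, aeval x (pderiv j (G i)) • KaehlerDifferential.D k Q (x j) = 0
      rw [← derivation_aeval, hG, map_zero]
    have h1 := f.finrank_range_add_finrank_ker
    rw [hsurj, finrank_top, Module.finrank_eq_card_basis b, Module.finrank_fin_fun] at h1
    rw [Matrix.rank_eq_finrank_span_row]
    exact (Nat.add_le_add_left (Submodule.finrank_mono hker) _).trans h1.le

end

/-! ### The incidence ring of conormal vectors -/

noncomputable section

section Incidence

variable {R Q : Type*} [CommRing R] [Field Q] (τ : R →+* Q) {k m : ℕ}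
  (G : Matrix (Fin k) (Fin m) R) (b : Fin m → R) (c : ℕ)

/-- The ideal of the incidence variety `{(x, η) | b(x) - η ∈ row space of G(x)}`, over the integral
subscheme `Spec (R / ker τ)`: the vectors `b - η` for which the rank of `G`, bordered by `b - η`,
is at most `c`. The variables are the coordinates of `η`. -/
def incidenceIdeal : Ideal (MvPolynomial (Fin m) R) :=
  minorIdeal (c + 1) (consRow (fun j => C (b j) - X j) (G.map C)) ⊔ (RingHom.ker τ).map C

/-- The parametrization `η = b + ∑ l, Y l • G l` of the incidence variety over the generic point. -/
def paramHom : MvPolynomial (Fin m) R →+* MvPolynomial (Fin k) Q :=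
  eval₂Hom (C.comp τ) fun j => C (τ (b j)) + ∑ l, X l * C (τ (G l j))

/-- Minors of a matrix whose rows are combinations of the rows of `G` vanish with the minors
of `G`. -/
theorem det_consRow_combination {S : Type*} [CommRing S] {r : ℕ} (G : Matrix (Fin k) (Fin m) S)
    (y : Fin k → S) (h : ∀ (s : Fin r → Fin k) (t : Fin r → Fin m), (G.submatrix s t).det = 0)
    (s : Fin r → Fin (k + 1)) (t : Fin r → Fin m) :
    ((consRow (fun j => ∑ l, y l * G l j) G).submatrix s t).det = 0 := by
  classical
  have : (consRow (fun j => ∑ l, y l * G l j) G).submatrix s t =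
      (Matrix.of fun (i : Fin r) (l : Fin k) =>
        (Fin.cons (y l) (fun l' => if l' = l then 1 else 0) : Fin (k + 1) → S) (s i)) *
      G.submatrix id t := by
    ext i j
    rw [Matrix.mul_apply]
    simp only [Matrix.submatrix_apply, Matrix.of_apply, id]
    cases s i using Fin.cases with
    | zero => simp
    | succ l => simp
  rw [this]
  exact det_mul_eq_zero_of_minors _ _ fun s' => h s' t

variable (hminor : ∀ (s : Fin (c + 1) → Fin k) (t : Fin (c + 1) → Fin m),
  τ (G.submatrix s t).det = 0)

include hminor in
theorem incidenceIdeal_le_ker : incidenceIdeal τ G b c ≤ RingHom.ker (paramHom τ G b) := by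
  refine sup_le (Ideal.span_le.mpr ?_) (Ideal.map_le_iff_le_comap.mpr fun r hr => ?_)
  · rintro _ ⟨⟨s, t⟩, rfl⟩
    change paramHom τ G b _ = 0
    rw [RingHom.map_det]
    have h := det_consRow_combination (r := c + 1) (G.map fun a => (C (τ a) : MvPolynomial (Fin k) Q))
      (fun l => - X l) (fun s t => by
        have := hminor s t
        rw [RingHom.map_det] at this
        have h2 := congrArg (C : Q →+* MvPolynomial (Fin k) Q) this
        rw [RingHom.map_det, map_zero] at h2
        exact h2) s t
    rw [← h]
    congr 1
    ext i j : 2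
    simp only [RingHom.mapMatrix_apply, Matrix.map_apply, Matrix.submatrix_apply, Matrix.of_apply]
    cases s i using Fin.cases with
    | zero => simp [paramHom]
    | succ l => simp [paramHom]
  · change paramHom τ G b (C r) = 0
    rw [RingHom.mem_ker] at hr
    simp [paramHom, hr]

/-- Where the minor `Δ` with columns `t` is invertible, the incidence ring is generated by the
coordinates `η (t i)`: they determine `η` by linear elimination. -/
theorem exists_pow_mul_sub_rename_mem (s : Fin c → Fin k) (t : Fin c → Fin m)
    (f : MvPolynomial (Fin m) R) :
    ∃ (N : ℕ) (f' : MvPolynomial (Fin c) R),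
      C (G.submatrix s t).det ^ N * f - rename t f' ∈ incidenceIdeal τ G b c := by
  set Δ := (G.submatrix s t).det with hΔ
  set J := incidenceIdeal τ G b c with hJ
  have hX : ∀ j, ∃ p : MvPolynomial (Fin c) R, C Δ * X j - rename t p ∈ J := by
    intro j
    have h1 := det_consRow_submatrix (C : R →+* MvPolynomial (Fin m) R) G
      (fun j => C (b j) - X j) s t j
    have h2 : ((consRow (fun j => C (b j) - X j) (G.map (C : R →+* MvPolynomial (Fin m) R))).submatrix
      (Fin.cons 0 fun i => (s i).succ : Fin (c + 1) → Fin (k + 1))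
      (Fin.cons j t : Fin (c + 1) → Fin m)).det ∈ J :=
      Ideal.mem_sup_left (Ideal.subset_span ⟨(_, _), rfl⟩)
    refine ⟨C (b j * Δ) + ∑ i, C (laplaceCoeff G s t j i) * (C (b (t i)) - X i), ?_⟩
    rw [h1] at h2
    rw [← neg_mem_iff]
    convert h2 using 1
    simp only [map_add, map_sum, map_mul, map_sub, rename_C, rename_X]
    ring
  induction f using MvPolynomial.induction_on with
  | C a => exact ⟨0, C a, by simp⟩
  | add f f₁ hf hf₁ =>
    obtain ⟨N, p, hp⟩ := hf
    obtain ⟨M, q, hq⟩ := hf₁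
    refine ⟨N + M, C Δ ^ M * p + C Δ ^ N * q, ?_⟩
    have := J.add_mem (J.mul_mem_left (C Δ ^ M) hp) (J.mul_mem_left (C Δ ^ N) hq)
    convert this using 1
    simp only [map_add, map_mul, map_pow, rename_C]
    ring
  | mul_X f j hf =>
    obtain ⟨N, p, hp⟩ := hf
    obtain ⟨q, hq⟩ := hX j
    refine ⟨N + 1, p * q, ?_⟩
    have := J.add_mem (J.mul_mem_left (C Δ * X j) hp) (J.mul_mem_left (rename t p) hq)
    convert this using 1
    simp only [map_mul]
    ring

/-- Where the minor with rows `s` and columns `t` is invertible, the parameters can be recovered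
from the coordinates `η (t i)`; the other parameters are set to `0`. -/
theorem exists_leftInverse_paramHom (s : Fin c → Fin k) (t : Fin c → Fin m)
    (hΔ : τ (G.submatrix s t).det ≠ 0) :
    ∃ ξ : MvPolynomial (Fin k) Q →ₐ[Q] MvPolynomial (Fin c) Q,
      ∀ f : MvPolynomial (Fin c) R, ξ (paramHom τ G b (rename t f)) = map τ f := by
  classical
  set M : Matrix (Fin c) (Fin c) Q := (G.submatrix s t).map τ with hM
  have hMdet : IsUnit M.det := by
    rw [isUnit_iff_ne_zero, hM]
    rwa [RingHom.map_det] at hΔ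
  -- the rows of `G` indexed by `s` get the coefficients `M⁻¹ᵀ (Y - b)`
  let y : Fin c → MvPolynomial (Fin c) Q := fun i => ∑ l, (X l - C (τ (b (t l)))) * C (M⁻¹ l i)
  let ξ : MvPolynomial (Fin k) Q →ₐ[Q] MvPolynomial (Fin c) Q :=
    aeval fun l => ∑ i, if s i = l then y i else 0
  refine ⟨ξ, fun f => ?_⟩
  have key : ∀ l' : Fin c, ∑ i, y i * C (τ (G (s i) (t l'))) = X l' - C (τ (b (t l'))) := by
    intro l'
    simp only [y, Finset.sum_mul]
    rw [Finset.sum_comm]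
    have h2 : ∀ l, ∑ i, M⁻¹ l i * τ (G (s i) (t l')) = if l = l' then 1 else 0 := by
      intro l
      have := congrFun (congrFun (Matrix.nonsing_inv_mul M hMdet) l) l'
      rw [Matrix.mul_apply, Matrix.one_apply] at this
      exact this
    have h3 : ∀ l, ∑ i, (X l - C (τ (b (t l)))) * C (M⁻¹ l i) * C (τ (G (s i) (t l'))) =
        (X l - C (τ (b (t l)))) * C (if l = l' then (1 : Q) else 0) := by
      intro l
      rw [← h2, map_sum, Finset.mul_sum]
      exact Finset.sum_congr rfl fun i _ => by rw [mul_assoc, C_mul]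
    simp only [h3]
    rw [Finset.sum_eq_single l']
    · simp
    · intro l _ hl
      simp [hl]
    · simp
  have h4 : (ξ.toRingHom.comp (paramHom τ G b)).comp (rename t).toRingHom = map τ := by
    apply MvPolynomial.ringHom_ext
    · intro r
      simp [paramHom, ξ]
    · intro l'
      have h5 : ∑ l, (∑ i, if s i = l then y i else 0) * C (τ (G l (t l'))) =
          ∑ i, y i * C (τ (G (s i) (t l'))) := by
        simp only [Finset.sum_mul]
        rw [Finset.sum_comm]
        exact Finset.sum_congr rfl fun i _ => by simp
      simp only [paramHom, ξ, AlgHom.toRingHom_eq_coe, RingHom.comp_apply, RingHom.coe_coe,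
        rename_X, coe_eval₂Hom, eval₂_X, map_add, map_sum, map_mul, aeval_X, map_X,
        algHom_C, algebraMap_eq, h5, key]
      ring
  exact RingHom.congr_fun h4 f

/-- Where the minor with rows `s` and columns `t` is invertible, a homomorphism that factors through
the parametrization and is injective on the coordinates `η (t i)` kills only the incidence ideal:
without inverting the minor, a power of it multiplies the kernel into that ideal. -/
theorem pow_mul_mem_incidenceIdeal (s : Fin c → Fin k) (t : Fin c → Fin m)
    {σ : Type*} (ξ : MvPolynomial (Fin k) Q →+* MvPolynomial σ Q)
    (hker : incidenceIdeal τ G b c ≤ RingHom.ker (ξ.comp (paramHom τ G b)))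
    (hξ : ∀ f : MvPolynomial (Fin c) R, ξ (paramHom τ G b (rename t f)) = 0 → map τ f = 0)
    (f : MvPolynomial (Fin m) R) (hf : ξ (paramHom τ G b f) = 0) :
    ∃ N : ℕ, C (G.submatrix s t).det ^ N * f ∈ incidenceIdeal τ G b c := by
  obtain ⟨N, f', h⟩ := exists_pow_mul_sub_rename_mem τ G b c s t f
  refine ⟨N, ?_⟩
  have h1 : ξ (paramHom τ G b (C (G.submatrix s t).det ^ N * f - rename t f')) = 0 := hker h
  rw [map_sub, map_sub, map_mul, map_mul, hf, mul_zero, zero_sub, neg_eq_zero] at h1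
  have h2 := hξ f' h1
  have h3 : f' ∈ (RingHom.ker τ).map (C : R →+* MvPolynomial (Fin c) R) := by
    rw [← ker_map]; exact h2
  have h4 : rename t f' ∈ incidenceIdeal τ G b c := by
    refine Ideal.mem_sup_right ?_
    have h5 := Ideal.mem_map_of_mem (rename (R := R) t).toRingHom h3
    rw [Ideal.map_map, show (rename (R := R) t).toRingHom.comp C = C from
      RingHom.ext fun r => rename_C t r] at h5
    exact h5
  simpa using add_mem h h4

variable (hunit : Ideal.span (Set.range fun st : (Fin c → Fin k) × (Fin c → Fin m) =>
  (G.submatrix st.1 st.2).det) ⊔ RingHom.ker τ = ⊤)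

include hunit in
theorem exists_map_minor_ne_zero :
    ∃ (s : Fin c → Fin k) (t : Fin c → Fin m), τ (G.submatrix s t).det ≠ 0 := by
  by_contra! h
  have : (⊤ : Ideal R) ≤ RingHom.ker τ := by
    rw [← hunit]
    refine sup_le (Ideal.span_le.mpr ?_) le_rfl
    rintro _ ⟨⟨s, t⟩, rfl⟩
    exact h s t
  exact RingHom.ker_ne_top τ (top_le_iff.mp this)

include hminor hunit in
/-- The incidence ideal is the kernel of the parametrization. This is local on the base, and the
minors of size `c` generate the unit ideal. -/
theorem ker_paramHom : RingHom.ker (paramHom τ G b) = incidenceIdeal τ G b c := by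
  refine le_antisymm (fun f hf => ?_) (incidenceIdeal_le_ker τ G b c hminor)
  set J := incidenceIdeal τ G b c with hJ
  -- the ideal of the elements of `R` that multiply `f` into `J`
  let D : Ideal R := (J.colon {f}).comap C
  have hD : ∀ r, r ∈ D ↔ C r * f ∈ J := fun r => by
    simp only [D, Ideal.mem_comap, Submodule.mem_colon_singleton, smul_eq_mul]
  have hker : RingHom.ker τ ≤ D := fun r hr => by
    rw [hD]
    exact J.mul_mem_right _ (Ideal.mem_sup_right (Ideal.mem_map_of_mem C hr))
  have htop : D.radical = ⊤ := by
    rw [eq_top_iff, ← hunit]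
    refine sup_le (Ideal.span_le.mpr ?_) (hker.trans Ideal.le_radical)
    rintro _ ⟨⟨s, t⟩, rfl⟩
    by_cases hΔ : τ (G.submatrix s t).det = 0
    · exact Ideal.le_radical (hker hΔ)
    · obtain ⟨ξ, hξ⟩ := exists_leftInverse_paramHom τ G b c s t hΔ
      obtain ⟨N, hN⟩ := pow_mul_mem_incidenceIdeal τ G b c s t (RingHom.id _)
        (incidenceIdeal_le_ker τ G b c hminor) (fun f h => by
          rw [← hξ f]
          rw [RingHom.id_apply] at h
          rw [h, map_zero]) f hf
      refine ⟨N, ?_⟩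
      rw [hD, map_pow]
      exact hN
  rw [Ideal.radical_eq_top] at htop
  have h1 : (1 : R) ∈ D := by rw [htop]; trivial
  rw [hD, map_one, one_mul] at h1
  exact h1

include hminor hunit in
theorem incidenceIdeal_isPrime : (incidenceIdeal τ G b c).IsPrime := by
  rw [← ker_paramHom τ G b c hminor hunit]
  exact RingHom.ker_isPrime _

include hminor hunit in
/-- The incidence ring embeds into a polynomial ring in `c` variables over the function field. -/
theorem exists_hom_ker_eq_incidenceIdeal :
    ∃ θ : MvPolynomial (Fin m) R →+* MvPolynomial (Fin c) Q,
      (∀ r, θ (C r) = C (τ r)) ∧ RingHom.ker θ = incidenceIdeal τ G b c := by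
  have hJ := ker_paramHom τ G b c hminor hunit
  have hprime := incidenceIdeal_isPrime τ G b c hminor hunit
  obtain ⟨s, t, hΔ⟩ := exists_map_minor_ne_zero τ G c hunit
  obtain ⟨ξ, hξ⟩ := exists_leftInverse_paramHom τ G b c s t hΔ
  have hle : incidenceIdeal τ G b c ≤ RingHom.ker (ξ.toRingHom.comp (paramHom τ G b)) := by
    intro f hf
    rw [← hJ] at hf
    change ξ (paramHom τ G b f) = 0
    rw [RingHom.mem_ker] at hf
    rw [hf, map_zero]
  refine ⟨ξ.toRingHom.comp (paramHom τ G b), fun r => by simp [paramHom], le_antisymm ?_ hle⟩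
  intro f hf
  obtain ⟨N, hN⟩ := pow_mul_mem_incidenceIdeal τ G b c s t ξ.toRingHom hle
    (fun f h => by rw [← hξ f]; exact h) f hf
  refine (hprime.mem_or_mem hN).resolve_left fun h => hΔ ?_
  have h2 := hprime.mem_of_pow_mem _ h
  rw [← hJ] at h2
  have h3 : paramHom τ G b (C (G.submatrix s t).det) = 0 := h2
  simpa [paramHom] using h3

end Incidence

end

/-! ### The Jacobian matrix along the affine cone -/

noncomputable section

/-- The Jacobian matrix of `g₁, …, g_k`. -/
def jacobian {n k : ℕ} (g : Fin k → Poly n) : Matrix (Fin k) (Fin (n + 1)) (Poly n) :=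
  Matrix.of fun i j => pderiv j (g i)

theorem aeval_smul_of_isHomogeneous {R S σ : Type*} [CommRing R] [CommRing S] [Algebra R S]
    {p : MvPolynomial σ R} {m : ℕ} (hp : p.IsHomogeneous m) (a : S) (x : σ → S) :
    aeval (a • x) p = a ^ m * aeval x p := by
  rw [aeval_def, aeval_def, eval₂_eq, eval₂_eq, Finset.mul_sum]
  refine Finset.sum_congr rfl fun d hd => ?_
  have h1 : ∑ i ∈ d.support, d i = m := by
    have := hp (mem_support_iff.mp hd)
    rwa [Finsupp.weight_apply, Finsupp.sum, Finset.sum_congr rfl (g := fun i => d i) (by simp)] at this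
  simp only [Pi.smul_apply, smul_eq_mul, mul_pow, Finset.prod_mul_distrib,
    Finset.prod_pow_eq_pow_sum, h1]
  ring

theorem eval_smul_of_isHomogeneous {R σ : Type*} [CommRing R] {p : MvPolynomial σ R} {m : ℕ}
    (hp : p.IsHomogeneous m) (a : R) (x : σ → R) : eval (a • x) p = a ^ m * eval x p := by
  rw [← coe_aeval_eq_eval, ← coe_aeval_eq_eval]
  exact aeval_smul_of_isHomogeneous hp a x

variable {n k : ℕ} (g : Fin k → Poly n) (F : Poly n)

theorem eval_eq_zero_of_mem_idealOf {x : Fin (n + 1) → ℂ} (hx : ∀ i, eval x (g i) = 0) {p : Poly n}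
    (hp : p ∈ idealOf g) : eval x p = 0 := by
  have : idealOf g ≤ RingHom.ker (eval x) := by
    rw [Ideal.span_le]
    rintro _ ⟨i, rfl⟩
    exact hx i
  exact this hp

/-- By homogeneity, smoothness of `X` at the points outside `V(F)`, where the Jacobian matrix is
evaluated at a chosen representative, passes to all points of the cone outside `V(F)`. -/
theorem rank_jacobian_eval {d : ℕ} (hd : 0 < d) (hF : F.IsHomogeneous d)
    (hg : ∀ i, ∃ e : ℕ, (g i).IsHomogeneous e)
    (hsmooth : ∀ p ∈ projZeros g, eval p.rep F ≠ 0 → IsSmoothAt g p)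
    {x : Fin (n + 1) → ℂ} (hx : ∀ i, eval x (g i) = 0) (hFx : eval x F ≠ 0) :
    ((jacobian g).map (eval x)).rank = codim g := by
  have hx0 : x ≠ 0 := by
    rintro rfl
    have := eval_smul_of_isHomogeneous hF 0 (0 : Fin (n + 1) → ℂ)
    rw [zero_smul, zero_pow hd.ne', zero_mul] at this
    exact hFx this
  obtain ⟨a, ha⟩ := Projectivization.exists_smul_eq_mk_rep ℂ x hx0
  choose e he using hg
  set p := Projectivization.mk ℂ x hx0
  have ha' : p.rep = (a : ℂ) • x := ha.symm
  have hp : p ∈ projZeros g := fun i => by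
    rw [ha', eval_smul_of_isHomogeneous (he i), hx, mul_zero]
  have h1 := hsmooth p hp (by
    rw [ha', eval_smul_of_isHomogeneous hF]
    exact mul_ne_zero (pow_ne_zero _ a.ne_zero) hFx)
  rw [IsSmoothAt, ha'] at h1
  rw [← h1]
  have h2 : (Matrix.of fun (i : Fin k) (j : Fin (n + 1)) => eval ((a : ℂ) • x) (pderiv j (g i))) =
      Matrix.diagonal (fun i => (a : ℂ) ^ (e i - 1)) * (jacobian g).map (eval x) := by
    ext i j
    rw [Matrix.diagonal_mul, Matrix.of_apply, eval_smul_of_isHomogeneous (he i).pderiv]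
    rfl
  rw [h2, Matrix.rank_mul_eq_right_of_isUnit_det]
  rw [Matrix.det_diagonal, isUnit_iff_ne_zero]
  exact Finset.prod_ne_zero_iff.mpr fun i _ => pow_ne_zero _ a.ne_zero

theorem eval_det_submatrix {a b r : ℕ} (M : Matrix (Fin a) (Fin b) (Poly n)) (x : Fin (n + 1) → ℂ)
    (s : Fin r → Fin a) (t : Fin r → Fin b) :
    eval x (M.submatrix s t).det = ((M.map (eval x)).submatrix s t).det := by
  rw [RingHom.map_det]
  rfl

section Smooth

variable (hrank : ∀ x : Fin (n + 1) → ℂ, (∀ i, eval x (g i) = 0) → eval x F ≠ 0 →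
  ((jacobian g).map (eval x)).rank = codim g)

include hrank in
/-- These minors vanish on the part `F ≠ 0` of the cone, which is dense in the cone. -/
theorem minor_jacobian_mem [(idealOf g).IsPrime] (hFI : F ∉ idealOf g)
    (s : Fin (codim g + 1) → Fin k) (t : Fin (codim g + 1) → Fin (n + 1)) :
    ((jacobian g).submatrix s t).det ∈ idealOf g := by
  have h1 : F * ((jacobian g).submatrix s t).det ∈ idealOf g := by
    rw [← IsPrime.vanishingIdeal_zeroLocus (K := ℂ) (idealOf g)]
    intro x hx
    have hx' : ∀ i, eval x (g i) = 0 := fun i => hx _ (Ideal.subset_span ⟨i, rfl⟩)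
    change eval x _ = 0
    rw [map_mul, mul_eq_zero, or_iff_not_imp_left]
    intro hFx
    by_contra h0
    rw [eval_det_submatrix] at h0
    have h2 := le_rank_of_minor_ne_zero _ s t h0
    rw [hrank x hx' hFx] at h2
    omega
  exact (‹(idealOf g).IsPrime›.mem_or_mem h1).resolve_left hFI

include hrank in
/-- By the Nullstellensatz, the maximal nonvanishing minors of the Jacobian matrix generate the unit
ideal on the part `F ≠ 0` of the cone. -/
theorem mem_radical_minors_jacobian :
    F ∈ (Ideal.span (Set.range fun st : (Fin (codim g) → Fin k) × (Fin (codim g) → Fin (n + 1)) =>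
      ((jacobian g).submatrix st.1 st.2).det) ⊔ idealOf g).radical := by
  rw [← vanishingIdeal_zeroLocus_eq_radical (K := ℂ)]
  intro x hx
  by_contra hFx
  have hx' : ∀ i, eval x (g i) = 0 := fun i =>
    hx _ (Ideal.mem_sup_right (Ideal.subset_span ⟨i, rfl⟩))
  obtain ⟨s, t, h⟩ := exists_minor_ne_zero _ (hrank x hx' hFx).ge
  rw [← eval_det_submatrix] at h
  exact h (hx _ (Ideal.mem_sup_left (Ideal.subset_span ⟨(s, t), rfl⟩)))

end Smooth

/-! ### The function field of the affine cone -/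

/-- A domain that contains a polynomial ring and has no larger transcendence degree is algebraic
over it. -/
theorem isAlgebraic_of_trdeg_le {σ k : Type*} [Fintype σ] [Field k] (B : Type*) [CommRing B]
    [IsDomain B] [Algebra k B] [Algebra (MvPolynomial σ k) B] [IsScalarTower k (MvPolynomial σ k) B]
    [FaithfulSMul (MvPolynomial σ k) B] (h : Algebra.trdeg k B ≤ Fintype.card σ) :
    Algebra.IsAlgebraic (MvPolynomial σ k) B := by
  let y : σ → B := fun j => algebraMap (MvPolynomial σ k) B (X j)
  have hy' : (aeval y : MvPolynomial σ k →ₐ[k] B) = IsScalarTower.toAlgHom k (MvPolynomial σ k) B := by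
    ext j
    simp [y]
  have hy : AlgebraicIndependent k y := by
    rw [AlgebraicIndependent, hy']
    exact FaithfulSMul.algebraMap_injective (MvPolynomial σ k) B
  have hb : IsTranscendenceBasis k y := by
    apply hy.isTranscendenceBasis_of_lift_trdeg_le_of_finite
    simpa using h
  have := hb.isAlgebraic
  refine Algebra.IsAlgebraic.of_ringHom_of_comp_eq (S := Algebra.adjoin k (Set.range y)) (B := B)
      hy.aevalEquiv.toRingHom (RingHom.id B) hy.aevalEquiv.surjective (fun _ _ h => h) ?_
  refine RingHom.ext fun p => ?_
  refine (hy.algebraMap_aevalEquiv p).trans ?_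
  rw [hy']
  rfl

variable [hI : (idealOf g).IsPrime] (hFI : F ∉ idealOf g)

omit hI in
theorem toField_eq_zero_iff {p : Poly n} : toField g p = 0 ↔ p ∈ idealOf g := by
  rw [← Ideal.Quotient.eq_zero_iff_mem]
  exact map_eq_zero_iff (algebraMap (Poly n ⧸ idealOf g) (ConeField g)) (IsFractionRing.injective _ _)

theorem toField_surj (z : ConeField g) : ∃ a b : Poly n, toField g b ≠ 0 ∧
    z = toField g a / toField g b := by
  obtain ⟨a, b, hb, rfl⟩ := IsFractionRing.div_surjective (A := Poly n ⧸ idealOf g) z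
  obtain ⟨a, rfl⟩ := Ideal.Quotient.mk_surjective a
  obtain ⟨b, rfl⟩ := Ideal.Quotient.mk_surjective b
  have hb0 : algebraMap (Poly n ⧸ idealOf g) (ConeField g) (Ideal.Quotient.mk _ b) ≠ 0 :=
    IsFractionRing.to_map_ne_zero_of_mem_nonZeroDivisors hb
  exact ⟨a, b, hb0, rfl⟩

omit hI in
theorem aeval_toField_X (p : Poly n) : aeval (fun j => toField g (X j)) p = toField g p := by
  have : (aeval (fun j => toField g (X j)) : Poly n →ₐ[ℂ] ConeField g).toRingHom = toField g := by
    apply MvPolynomial.ringHom_ext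
    · intro r
      simp
      rfl
    · intro j
      simp
  exact RingHom.congr_fun this p

/-- The inclusion of the coordinate ring of the part `F ≠ 0` of the affine cone in its field of
fractions, as a homomorphism from `ℂ[x₀, …, xₙ, 1/F]`. -/
def awayToField : Localization.Away F →+* ConeField g :=
  IsLocalization.Away.lift F (g := toField g)
    (isUnit_iff_ne_zero.mpr fun h => hFI ((toField_eq_zero_iff g).mp h))

theorem awayToField_algebraMap (p : Poly n) :
    awayToField g F hFI (algebraMap (Poly n) (Localization.Away F) p) = toField g p :=
  IsLocalization.Away.lift_eq F _ p

theorem ker_awayToField : RingHom.ker (awayToField g F hFI) =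
    (idealOf g).map (algebraMap (Poly n) (Localization.Away F)) := by
  apply le_antisymm
  · intro z hz
    obtain ⟨N, a, ha⟩ := IsLocalization.Away.surj F z
    have h1 : toField g a = 0 := by
      rw [← awayToField_algebraMap g F hFI, ← ha, map_mul, (RingHom.mem_ker.mp hz), zero_mul]
    have hu : IsUnit (algebraMap (Poly n) (Localization.Away F) F ^ N) :=
      IsLocalization.Away.algebraMap_pow_isUnit F N
    rw [← Ideal.mul_unit_mem_iff_mem _ hu, ha]
    exact Ideal.mem_map_of_mem _ ((toField_eq_zero_iff g).mp h1)
  · rw [Ideal.map_le_iff_le_comap]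
    intro p hp
    change awayToField g F hFI _ = 0
    rw [awayToField_algebraMap]
    exact (toField_eq_zero_iff g).mpr hp

/-- The dimension bound `dim ≤ n + 1 - c` for the affine cone, from a nonzero minor of size `c` of the
Jacobian matrix. -/
theorem exists_trdeg_coneField (c : ℕ) (s : Fin c → Fin k) (t : Fin c → Fin (n + 1))
    (h : toField g ((jacobian g).submatrix s t).det ≠ 0) :
    ∃ r : ℕ, Algebra.trdeg ℂ (ConeField g) = r ∧ r + c ≤ n + 1 := by
  let x : Fin (n + 1) → ConeField g := fun j => toField g (X j)
  have hx : ∀ p, aeval x p = toField g p := aeval_toField_X g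
  have halg : Algebra.IsAlgebraic (Algebra.adjoin ℂ (Set.range x)) (ConeField g) := by
    refine ⟨fun z => ?_⟩
    obtain ⟨a, b, -, rfl⟩ := toField_surj g z
    have hmem : ∀ p, toField g p ∈ Algebra.adjoin ℂ (Set.range x) := fun p => by
      rw [← hx, Algebra.adjoin_range_eq_range_aeval]
      exact ⟨p, rfl⟩
    have h1 : ∀ p, IsAlgebraic (Algebra.adjoin ℂ (Set.range x)) (toField g p) := fun p =>
      isAlgebraic_algebraMap (⟨toField g p, hmem p⟩ : Algebra.adjoin ℂ (Set.range x))
    rw [div_eq_mul_inv]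
    exact (h1 a).mul (h1 b).inv
  obtain ⟨r, hr, hle⟩ := trdeg_add_rank_le x g fun i => by
    rw [hx, toField_eq_zero_iff]
    exact Ideal.subset_span ⟨i, rfl⟩
  refine ⟨r, hr, (Nat.add_le_add_left (le_rank_of_minor_ne_zero _ s t ?_) _).trans hle⟩
  rw [RingHom.map_det] at h
  have e : (Matrix.of fun (i : Fin k) (j : Fin (n + 1)) => aeval x (pderiv j (g i))).submatrix s t =
      (toField g).mapMatrix ((jacobian g).submatrix s t) := by
    ext i j
    exact hx _
  rwa [e]

end

/-! ### The incidence ring of critical points and its fibres -/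

noncomputable section

variable {n k : ℕ} (g : Fin k → Poly n) (F : Poly n)

/-- The vector `∇F / F` over `ℂ[x₀, …, xₙ, 1/F]`. -/
def logGrad (j : Fin (n + 1)) : Localization.Away F :=
  algebraMap (Poly n) (Localization.Away F) (pderiv j F) * IsLocalization.Away.invSelf F

/-- The Jacobian matrix over `ℂ[x₀, …, xₙ, 1/F]`. -/
def awayJacobian : Matrix (Fin k) (Fin (n + 1)) (Localization.Away F) :=
  (jacobian g).map (algebraMap (Poly n) (Localization.Away F))

theorem matrixA_eq (η : Fin (n + 1) → ℂ) : matrixA F g η =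
    consRow (fun j => logGrad F j - algebraMap (Poly n) (Localization.Away F) (C (η j)))
      (awayJacobian g F) := rfl

theorem algebraMap_C_eq (r : ℂ) : algebraMap (Poly n) (Localization.Away F) (C r) =
    algebraMap ℂ (Localization.Away F) r :=
  (IsScalarTower.algebraMap_apply ℂ (Poly n) (Localization.Away F) r).symm

section

variable [hI : (idealOf g).IsPrime] (hFI : F ∉ idealOf g)

/-- The ring of the incidence variety of pairs `(x, η)` of a vector `η` and a critical point `x`
of `log F - η` on the part `F ≠ 0` of the affine cone. -/
def LikelihoodRing : Type :=
  MvPolynomial (Fin (n + 1)) (Localization.Away F) ⧸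
    incidenceIdeal (awayToField g F hFI) (awayJacobian g F) (logGrad F) (codim g)

instance : CommRing (LikelihoodRing g F hFI) :=
  inferInstanceAs (CommRing (MvPolynomial (Fin (n + 1)) (Localization.Away F) ⧸
    incidenceIdeal (awayToField g F hFI) (awayJacobian g F) (logGrad F) (codim g)))

instance : Algebra ℂ (LikelihoodRing g F hFI) :=
  inferInstanceAs (Algebra ℂ (MvPolynomial (Fin (n + 1)) (Localization.Away F) ⧸
    incidenceIdeal (awayToField g F hFI) (awayJacobian g F) (logGrad F) (codim g)))

/-- The projection to the incidence ring of the ring of polynomials in the coordinates of `η` with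
coefficients in `ℂ[x₀, …, xₙ, 1/F]`. -/
def toLikelihoodRing :
    MvPolynomial (Fin (n + 1)) (Localization.Away F) →ₐ[ℂ] LikelihoodRing g F hFI :=
  Ideal.Quotient.mkₐ ℂ _

theorem toLikelihoodRing_surjective : Function.Surjective (toLikelihoodRing g F hFI) :=
  Ideal.Quotient.mkₐ_surjective ℂ _

theorem toLikelihoodRing_eq_zero {f : MvPolynomial (Fin (n + 1)) (Localization.Away F)} :
    toLikelihoodRing g F hFI f = 0 ↔
      f ∈ incidenceIdeal (awayToField g F hFI) (awayJacobian g F) (logGrad F) (codim g) :=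
  Ideal.Quotient.eq_zero_iff_mem

/-- The incidence variety lies over the affine space of the vectors `η`: here the variables of
`Poly n` are the coordinates of `η`, not of `x`. -/
instance : Algebra (Poly n) (LikelihoodRing g F hFI) :=
  ((toLikelihoodRing g F hFI).toRingHom.comp
    (map (algebraMap ℂ (Localization.Away F)))).toAlgebra

theorem likelihoodRing_algebraMap_C (r : ℂ) :
    algebraMap (Poly n) (LikelihoodRing g F hFI) (C r) =
      toLikelihoodRing g F hFI (C (algebraMap (Poly n) (Localization.Away F) (C r))) := by
  change toLikelihoodRing g F hFI (map (algebraMap ℂ (Localization.Away F)) (C r)) = _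
  rw [map_C, algebraMap_C_eq]

theorem likelihoodRing_algebraMap_X (j : Fin (n + 1)) :
    algebraMap (Poly n) (LikelihoodRing g F hFI) (X j) = toLikelihoodRing g F hFI (X j) := by
  change toLikelihoodRing g F hFI (map (algebraMap ℂ (Localization.Away F)) (X j)) = _
  rw [map_X]

instance : IsScalarTower ℂ (Poly n) (LikelihoodRing g F hFI) :=
  IsScalarTower.of_algebraMap_eq fun r => by
    change _ = algebraMap (Poly n) (LikelihoodRing g F hFI) (C r)
    rw [likelihoodRing_algebraMap_C, algebraMap_C_eq]
    rfl

/-- The specialization at `η` of the coefficients of the likelihood equations. -/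
def specHom (η : Fin (n + 1) → ℂ) :
    MvPolynomial (Fin (n + 1)) (Localization.Away F) →+* CritRing F g η :=
  eval₂Hom (Ideal.Quotient.mk (critIdeal F g η)) fun j =>
    Ideal.Quotient.mk (critIdeal F g η) (algebraMap (Poly n) (Localization.Away F) (C (η j)))

theorem specHom_eq_zero (η : Fin (n + 1) → ℂ)
    {f : MvPolynomial (Fin (n + 1)) (Localization.Away F)}
    (hf : f ∈ incidenceIdeal (awayToField g F hFI) (awayJacobian g F) (logGrad F) (codim g)) :
    specHom g F η f = 0 := by
  have : incidenceIdeal (awayToField g F hFI) (awayJacobian g F) (logGrad F) (codim g) ≤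
      RingHom.ker (specHom g F η) := by
    refine sup_le (Ideal.span_le.mpr ?_) (Ideal.map_le_iff_le_comap.mpr fun r hr => ?_)
    · rintro _ ⟨⟨s, t⟩, rfl⟩
      have h1 : Ideal.Quotient.mk (critIdeal F g η) ((matrixA F g η).submatrix s t).det = 0 :=
        Ideal.Quotient.eq_zero_iff_mem.mpr (Ideal.mem_sup_left (Ideal.subset_span ⟨(s, t), rfl⟩))
      change specHom g F η _ = 0
      rw [← h1, RingHom.map_det, RingHom.map_det]
      congr 1
      ext i j : 2
      rw [matrixA_eq]
      simp only [RingHom.mapMatrix_apply, Matrix.map_apply, Matrix.submatrix_apply, Matrix.of_apply]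
      cases s i using Fin.cases with
      | zero => simp [specHom]
      | succ l => simp [specHom]
    · rw [ker_awayToField] at hr
      change specHom g F η (C r) = 0
      rw [specHom, coe_eval₂Hom, eval₂_C, Ideal.Quotient.eq_zero_iff_mem]
      exact Ideal.mem_sup_right hr
  exact this hf

/-- The scheme of critical points for `η` as a closed subscheme of the incidence variety. -/
def likelihoodSpec (η : Fin (n + 1) → ℂ) : LikelihoodRing g F hFI →+* CritRing F g η :=
  Ideal.Quotient.lift _ (specHom g F η) fun _ hf => specHom_eq_zero g F hFI η hf

theorem likelihoodSpec_toLikelihoodRing (η : Fin (n + 1) → ℂ)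
    (f : MvPolynomial (Fin (n + 1)) (Localization.Away F)) :
    likelihoodSpec g F hFI η (toLikelihoodRing g F hFI f) = specHom g F η f :=
  Ideal.Quotient.lift_mk _ _ _

theorem likelihoodSpec_surjective (η : Fin (n + 1) → ℂ) :
    Function.Surjective (likelihoodSpec g F hFI η) := by
  intro z
  obtain ⟨r, rfl⟩ := Ideal.Quotient.mk_surjective z
  refine ⟨toLikelihoodRing g F hFI (C r), ?_⟩
  rw [likelihoodSpec_toLikelihoodRing, specHom, coe_eval₂Hom, eval₂_C]

theorem likelihoodSpec_comp_algebraMap (η : Fin (n + 1) → ℂ) :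
    (likelihoodSpec g F hFI η).comp (algebraMap (Poly n) (LikelihoodRing g F hFI)) =
      (algebraMap ℂ (CritRing F g η)).comp (eval η) := by
  have hC : ∀ r : ℂ, Ideal.Quotient.mk (critIdeal F g η)
      (algebraMap (Poly n) (Localization.Away F) (C r)) = algebraMap ℂ (CritRing F g η) r := by
    intro r
    rw [algebraMap_C_eq]
    rfl
  apply MvPolynomial.ringHom_ext
  · intro r
    rw [RingHom.comp_apply, likelihoodRing_algebraMap_C, likelihoodSpec_toLikelihoodRing,
      specHom, coe_eval₂Hom, eval₂_C, hC, RingHom.comp_apply, eval_C]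
  · intro j
    rw [RingHom.comp_apply, likelihoodRing_algebraMap_X, likelihoodSpec_toLikelihoodRing,
      specHom, coe_eval₂Hom, eval₂_X, hC, RingHom.comp_apply, eval_X]

/-- A complex point of the incidence variety over `η` is a critical point. -/
theorem exists_critRing_hom (η : Fin (n + 1) → ℂ) (φ : LikelihoodRing g F hFI →+* ℂ)
    (hφ : φ.comp (algebraMap (Poly n) (LikelihoodRing g F hFI)) = eval η) :
    ∃ ψ : CritRing F g η →ₐ[ℂ] ℂ, ∀ r : Localization.Away F,
      ψ (Ideal.Quotient.mk _ r) = φ (toLikelihoodRing g F hFI (C r)) := by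
  let φ' : Localization.Away F →+* ℂ := φ.comp ((toLikelihoodRing g F hFI).toRingHom.comp C)
  have hη : ∀ p, φ (algebraMap (Poly n) (LikelihoodRing g F hFI) p) = eval η p :=
    fun p => RingHom.congr_fun hφ p
  have hC : ∀ r : ℂ, φ' (algebraMap (Poly n) (Localization.Away F) (C r)) = r := fun r => by
    change φ (toLikelihoodRing g F hFI (C _)) = r
    rw [← likelihoodRing_algebraMap_C, hη, eval_C]
  have hle : critIdeal F g η ≤ RingHom.ker φ' := by
    refine sup_le (Ideal.span_le.mpr ?_) ?_
    · rintro _ ⟨⟨s, t⟩, rfl⟩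
      have h1 : (consRow (fun j => C (logGrad F j) - X j) ((awayJacobian g F).map C)
          |>.submatrix s t).det ∈
          incidenceIdeal (awayToField g F hFI) (awayJacobian g F) (logGrad F) (codim g) :=
        Ideal.mem_sup_left (Ideal.subset_span ⟨(s, t), rfl⟩)
      have h2 := congrArg φ ((toLikelihoodRing_eq_zero g F hFI).mpr h1)
      change φ' _ = 0
      rw [map_zero] at h2
      rw [← h2]
      change _ = (φ.comp (toLikelihoodRing g F hFI).toRingHom) _
      rw [RingHom.map_det, RingHom.map_det]
      congr 1
      ext i j : 2
      rw [matrixA_eq]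
      simp only [RingHom.mapMatrix_apply, Matrix.map_apply, Matrix.submatrix_apply, Matrix.of_apply]
      cases s i using Fin.cases with
      | zero =>
        simp only [Fin.cons_zero, map_sub, hC]
        change _ = φ (toLikelihoodRing g F hFI _) - φ (toLikelihoodRing g F hFI (X (t j)))
        rw [← likelihoodRing_algebraMap_X, hη, eval_X]
        rfl
      | succ l => rfl
    · intro r hr
      rw [← ker_awayToField g F hFI] at hr
      have h1 : C r ∈ incidenceIdeal (awayToField g F hFI) (awayJacobian g F) (logGrad F) (codim g) :=
        Ideal.mem_sup_right (Ideal.mem_map_of_mem _ hr)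
      change φ (toLikelihoodRing g F hFI (C r)) = 0
      rw [(toLikelihoodRing_eq_zero g F hFI).mpr h1, map_zero]
  let ψ : CritRing F g η →+* ℂ := Ideal.Quotient.lift _ φ' hle
  refine ⟨{ ψ with commutes' := fun r => ?_ }, fun r => Ideal.Quotient.lift_mk _ _ _⟩
  change ψ (Ideal.Quotient.mk _ (algebraMap ℂ (Localization.Away F) r)) = r
  rw [← algebraMap_C_eq]
  exact (Ideal.Quotient.lift_mk _ _ _).trans (hC r)

/-- The critical points for `η` are the complex points of the incidence variety over `η`. -/
theorem encard_coneCritPoints_eq (η : Fin (n + 1) → ℂ) :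
    (coneCritPoints F g η).encard =
      {φ : LikelihoodRing g F hFI →+* ℂ |
        φ.comp (algebraMap (Poly n) (LikelihoodRing g F hFI)) = eval η}.encard := by
  symm
  refine Set.encard_congr (Equiv.ofBijective (fun φ => ⟨fun j => φ.1 (toLikelihoodRing g F hFI
    (C (algebraMap (Poly n) (Localization.Away F) (X j)))), ?_⟩) ⟨?_, ?_⟩)
  · obtain ⟨ψ, hψ⟩ := exists_critRing_hom g F hFI η φ.1 φ.2
    exact ⟨ψ, fun j => hψ _⟩
  · rintro ⟨φ, hφ⟩ ⟨ψ, hψ⟩ h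
    apply Subtype.ext
    have h1 : ∀ j, φ (toLikelihoodRing g F hFI (C (algebraMap (Poly n) (Localization.Away F) (X j)))) =
        ψ (toLikelihoodRing g F hFI (C (algebraMap (Poly n) (Localization.Away F) (X j)))) :=
      fun j => congrFun (congrArg Subtype.val h) j
    have hη : ∀ p, φ (algebraMap (Poly n) (LikelihoodRing g F hFI) p) =
        ψ (algebraMap (Poly n) (LikelihoodRing g F hFI) p) :=
      fun p => RingHom.congr_fun (hφ.trans hψ.symm) p
    refine Ideal.Quotient.ringHom_ext (I := incidenceIdeal (awayToField g F hFI)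
      (awayJacobian g F) (logGrad F) (codim g)) (MvPolynomial.ringHom_ext' ?_ fun j => ?_)
    · apply IsLocalization.ringHom_ext (Submonoid.powers F)
      apply MvPolynomial.ringHom_ext
      · intro r
        have := hη (C r)
        rw [likelihoodRing_algebraMap_C] at this
        exact this
      · exact h1
    · have := hη (X j)
      rw [likelihoodRing_algebraMap_X] at this
      exact this
  · rintro ⟨x, ψ, hψ⟩
    refine ⟨⟨ψ.toRingHom.comp (likelihoodSpec g F hFI η), ?_⟩, Subtype.ext (funext fun j => ?_)⟩
    · change (ψ.toRingHom.comp (likelihoodSpec g F hFI η)).comp _ = _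
      rw [RingHom.comp_assoc, likelihoodSpec_comp_algebraMap, ← RingHom.comp_assoc]
      ext p
      · simp
      · simp
    · refine Eq.trans ?_ (hψ j)
      change ψ (likelihoodSpec g F hFI η (toLikelihoodRing g F hFI _)) = _
      rw [likelihoodSpec_toLikelihoodRing, specHom, coe_eval₂Hom, eval₂_C]

end

/-- Generic reducedness of the scheme of critical points and constancy of their number, by the
generic structure of the fibres of the incidence variety over the space of the vectors `η`. -/
theorem exists_generic_card [hI : (idealOf g).IsPrime]
    (hrank : ∀ x : Fin (n + 1) → ℂ, (∀ i, eval x (g i) = 0) → eval x F ≠ 0 →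
      ((jacobian g).map (eval x)).rank = codim g) :
    ∃ N : ℕ, Generic fun η : Fin (n + 1) → ℂ =>
      IsReduced (CritRing F g η) ∧ (coneCritPoints F g η).encard = N := by
  have hempty : ∀ η, Subsingleton (CritRing F g η) →
      IsReduced (CritRing F g η) ∧ (coneCritPoints F g η).encard = (0 : ℕ) := by
    intro η _
    refine ⟨inferInstance, ?_⟩
    rw [Nat.cast_zero, Set.encard_eq_zero, Set.eq_empty_iff_forall_notMem]
    rintro x ⟨φ, -⟩
    have h1 : φ 1 = φ 0 := congrArg φ (Subsingleton.elim _ _)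
    rw [map_one, map_zero] at h1
    exact one_ne_zero h1
  -- if `F` vanishes identically on `X`, there are no critical points
  by_cases hFI : F ∈ idealOf g
  · refine ⟨0, 1, one_ne_zero, fun η _ => hempty η ?_⟩
    rw [Ideal.Quotient.subsingleton_iff, Ideal.eq_top_iff_one]
    have hu : IsUnit (algebraMap (Poly n) (Localization.Away F) F) :=
      IsLocalization.Away.algebraMap_isUnit F
    rw [← Ideal.eq_top_iff_one]
    exact Ideal.eq_top_of_isUnit_mem _ (Ideal.mem_sup_right (Ideal.mem_map_of_mem _ hFI)) hu
  set c := codim g with hc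
  set τ := awayToField g F hFI with hτ
  have hminor : ∀ (s : Fin (c + 1) → Fin k) (t : Fin (c + 1) → Fin (n + 1)),
      τ ((awayJacobian g F).submatrix s t).det = 0 := by
    intro s t
    have h1 : ((awayJacobian g F).submatrix s t).det =
        algebraMap (Poly n) (Localization.Away F) ((jacobian g).submatrix s t).det := by
      rw [RingHom.map_det]; rfl
    rw [h1, hτ, awayToField_algebraMap, toField_eq_zero_iff]
    exact minor_jacobian_mem g F hrank hFI s t
  have hunit : Ideal.span (Set.range fun st : (Fin c → Fin k) × (Fin c → Fin (n + 1)) =>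
      ((awayJacobian g F).submatrix st.1 st.2).det) ⊔ RingHom.ker τ = ⊤ := by
    obtain ⟨N, hN⟩ := mem_radical_minors_jacobian g F hrank
    have h1 := Ideal.mem_map_of_mem (algebraMap (Poly n) (Localization.Away F)) hN
    rw [Ideal.map_sup, Ideal.map_span, ← ker_awayToField g F hFI, map_pow, ← Set.range_comp] at h1
    have h2 := Ideal.eq_top_of_isUnit_mem _ h1 (IsLocalization.Away.algebraMap_pow_isUnit F N)
    rw [← h2]
    congr 3
    ext st
    rw [Function.comp_apply, RingHom.map_det]
    rfl
  have hprime : (incidenceIdeal τ (awayJacobian g F) (logGrad F) c).IsPrime :=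
    incidenceIdeal_isPrime τ (awayJacobian g F) (logGrad F) c hminor hunit
  let B := LikelihoodRing g F hFI
  have hdom : IsDomain B := Ideal.Quotient.isDomain (incidenceIdeal τ (awayJacobian g F) (logGrad F) c)
  have hft : Algebra.FiniteType (Poly n) B := by
    have h2 : Algebra.FiniteType ℂ (Localization.Away F) := inferInstance
    have h3 : Algebra.FiniteType ℂ (MvPolynomial (Fin (n + 1)) (Localization.Away F)) :=
      Algebra.FiniteType.trans (S := Localization.Away F) h2 inferInstance
    have h4 : Algebra.FiniteType ℂ B :=
      h3.of_surjective (toLikelihoodRing g F hFI) (toLikelihoodRing_surjective g F hFI)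
    exact Algebra.FiniteType.of_restrictScalars_finiteType ℂ (Poly n) B
  by_cases hinj : Function.Injective (algebraMap (Poly n) B)
  · have : FaithfulSMul (Poly n) B := (faithfulSMul_iff_algebraMap_injective _ _).mpr hinj
    -- the dimension count `(n + 1 - c) + c`
    have hle : Algebra.trdeg ℂ B ≤ Fintype.card (Fin (n + 1)) := by
      obtain ⟨θ, hθC, hθ⟩ :=
        exists_hom_ker_eq_incidenceIdeal τ (awayJacobian g F) (logGrad F) c hminor hunit
      let θ' : MvPolynomial (Fin (n + 1)) (Localization.Away F) →ₐ[ℂ]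
          MvPolynomial (Fin c) (ConeField g) :=
        { θ with
          commutes' := fun r => by
            change θ (C (algebraMap ℂ (Localization.Away F) r)) = C (algebraMap ℂ (ConeField g) r)
            rw [hθC, ← algebraMap_C_eq, hτ, awayToField_algebraMap]
            rfl }
      let θB : B →ₐ[ℂ] MvPolynomial (Fin c) (ConeField g) :=
        Ideal.Quotient.liftₐ _ θ' fun a ha => by
          rw [← hθ] at ha
          exact ha
      have hθB : Function.Injective θB := by
        rw [injective_iff_map_eq_zero]
        intro z hz
        obtain ⟨f, rfl⟩ := toLikelihoodRing_surjective g F hFI z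
        rw [toLikelihoodRing_eq_zero]
        change f ∈ incidenceIdeal τ (awayJacobian g F) (logGrad F) c
        rw [← hθ]
        exact hz
      obtain ⟨s, t, hst⟩ := exists_map_minor_ne_zero τ (awayJacobian g F) c hunit
      have hst' : toField g ((jacobian g).submatrix s t).det ≠ 0 := by
        rw [← awayToField_algebraMap g F hFI, RingHom.map_det]
        exact hst
      obtain ⟨r, hr, hrc⟩ := exists_trdeg_coneField g c s t hst'
      refine (trdeg_le_of_injective θB hθB).trans ?_
      rw [← trdeg_add_eq ℂ (ConeField g), hr, MvPolynomial.trdeg_of_isDomain]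
      simp only [Cardinal.mk_fin, Cardinal.lift_natCast, Fintype.card_fin]
      exact_mod_cast hrc
    have : Algebra.IsAlgebraic (Poly n) B := isAlgebraic_of_trdeg_le B hle
    obtain ⟨h, N, h0, H⟩ := exists_generic_fibre_card (A := Poly n) (B := B) (k := ℂ)
    refine ⟨N, h, h0, fun η hη => ?_⟩
    obtain ⟨H1, H2⟩ := H (eval η) (fun z => ⟨C z, eval_C z⟩) hη
    exact ⟨H2 (likelihoodSpec g F hFI η) (likelihoodSpec_surjective g F hFI η)
      (likelihoodSpec_comp_algebraMap g F hFI η), (encard_coneCritPoints_eq g F hFI η).trans H1⟩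
  -- otherwise the incidence variety lies over a hypersurface `h = 0`
  · rw [injective_iff_map_eq_zero] at hinj
    push Not at hinj
    obtain ⟨h, hh, h0⟩ := hinj
    refine ⟨0, h, h0, fun η hη => hempty η ?_⟩
    have h1 := RingHom.congr_fun (likelihoodSpec_comp_algebraMap g F hFI η) h
    rw [RingHom.comp_apply, RingHom.comp_apply] at h1
    have h2 : algebraMap ℂ (CritRing F g η) (eval η h) = 0 := by
      rw [← h1]
      exact (congrArg _ hh).trans (map_zero _)
    have h3 : IsUnit (algebraMap ℂ (CritRing F g η) (eval η h)) :=
      (isUnit_iff_ne_zero.mpr hη).map _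
    rw [h2, isUnit_zero_iff] at h3
    exact subsingleton_of_zero_eq_one h3

end

/-! ### Critical points on the cone and on the projective variety -/

noncomputable section

/-- A vector `w` is a combination of the rows of a matrix of rank `c` if it can be put on top of
the matrix without increasing the rank. -/
theorem exists_combination_of_minors {K : Type*} [Field K] {k m c : ℕ} (G : Matrix (Fin k) (Fin m) K)
    (w : Fin m → K) (s : Fin c → Fin k) (t : Fin c → Fin m) (hΔ : (G.submatrix s t).det ≠ 0)
    (hG : ∀ (s : Fin (c + 1) → Fin k) (t : Fin (c + 1) → Fin m), (G.submatrix s t).det = 0)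
    (hw : ∀ (s : Fin (c + 1) → Fin (k + 1)) (t : Fin (c + 1) → Fin m),
      ((consRow w G).submatrix s t).det = 0) :
    ∃ μ : Fin k → K, ∀ j, w j = ∑ l, μ l * G l j := by
  classical
  set M := G.submatrix s t with hM
  let ν : Fin c → K := Matrix.vecMul (fun i => w (t i)) M⁻¹
  let μ : Fin k → K := fun l => ∑ i, if s i = l then ν i else 0
  have hμ : ∀ j, ∑ l, μ l * G l j = ∑ i, ν i * G (s i) j := by
    intro j
    simp only [μ, Finset.sum_mul]
    rw [Finset.sum_comm]
    exact Finset.sum_congr rfl fun i _ => by simp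
  have ht : ∀ i, ∑ l, μ l * G l (t i) = w (t i) := by
    intro i
    have h1 : Matrix.vecMul ν M i = w (t i) := by
      simp only [ν]
      rw [Matrix.vecMul_vecMul, Matrix.nonsing_inv_mul _ (isUnit_iff_ne_zero.mpr hΔ),
        Matrix.vecMul_one]
    rw [hμ, ← h1]
    rfl
  refine ⟨μ, fun j => ?_⟩
  have h1 := det_consRow_submatrix (RingHom.id K) G w s t j
  have h2 := det_consRow_submatrix (RingHom.id K) G (fun j => ∑ l, μ l * G l j) s t j
  have hid : G.map (RingHom.id K) = G := rfl
  rw [hid, hw] at h1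
  rw [hid, det_consRow_combination G μ hG] at h2
  simp only [ht, RingHom.id_apply] at h1 h2
  refine mul_right_cancel₀ hΔ ?_
  linear_combination h2 - h1

/-- A linear form is a combination of finitely many others if it vanishes on their common kernel. -/
theorem exists_combination_of_forall {K : Type*} [Field K] {k m : ℕ} (G : Matrix (Fin k) (Fin m) K)
    (w : Fin m → K) (h : ∀ v : Fin m → K, (∀ l, ∑ j, G l j * v j = 0) → ∑ j, w j * v j = 0) :
    ∃ μ : Fin k → K, ∀ j, w j = ∑ l, μ l * G l j := by
  let L : (Fin m → K) → ((Fin m → K) →ₗ[K] K) := fun u =>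
    Fintype.linearCombination K u
  have hL : ∀ u v, L u v = ∑ j, u j * v j := fun u v => by
    simp [L, Fintype.linearCombination_apply, mul_comm]
  have h1 : L w ∈ Submodule.span K (Set.range fun l => L (G l)) := by
    apply mem_span_of_iInf_ker_le_ker
    intro v hv
    rw [LinearMap.mem_ker, hL]
    apply h v
    intro l
    rw [← hL]
    exact (Submodule.mem_iInf _).mp hv l
  obtain ⟨μ, hμ⟩ := (Submodule.mem_span_range_iff_exists_fun K).mp h1
  refine ⟨μ, fun j => ?_⟩
  have h2 := LinearMap.congr_fun hμ (Pi.single j 1)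
  simp only [LinearMap.sum_apply, LinearMap.smul_apply, hL, smul_eq_mul] at h2
  simpa [Pi.single_apply] using h2.symm

variable {n k : ℕ} (g : Fin k → Poly n) (F : Poly n)

/-- The vector `∇F(x) / F(x) - η` is normal to the affine cone over `X` at `x`: it is a combination
of the gradients of `g₁, …, g_k`. -/
def IsNormal (x η : Fin (n + 1) → ℂ) : Prop :=
  ∃ μ : Fin k → ℂ, ∀ j, eval x (pderiv j F) / eval x F - η j =
    ∑ l, μ l * eval x (pderiv j (g l))

/-- The Lagrange multiplier form of the rank condition that defines critical points. -/
theorem mem_coneCritPoints_iff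
    (hrank : ∀ x : Fin (n + 1) → ℂ, (∀ i, eval x (g i) = 0) → eval x F ≠ 0 →
      ((jacobian g).map (eval x)).rank = codim g) (x η : Fin (n + 1) → ℂ) :
    x ∈ coneCritPoints F g η ↔
      (∀ i, eval x (g i) = 0) ∧ eval x F ≠ 0 ∧ IsNormal g F x η := by
  have hmap : ∀ (ε : Localization.Away F →+* ℂ),
      (∀ p, ε (algebraMap (Poly n) (Localization.Away F) p) = eval x p) → eval x F ≠ 0 →
      (matrixA F g η).map ε = consRow (fun j => eval x (pderiv j F) / eval x F - η j)
        ((jacobian g).map (eval x)) := by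
    intro ε hε hFx
    have hinv : ε (IsLocalization.Away.invSelf F) = (eval x F)⁻¹ := by
      have := congrArg ε (IsLocalization.Away.mul_invSelf (S := Localization.Away F) F)
      rw [map_mul, hε, map_one] at this
      exact eq_inv_of_mul_eq_one_right this
    ext i j
    rw [matrixA_eq]
    cases i using Fin.cases with
    | zero => simp [logGrad, hε, hinv, div_eq_mul_inv]
    | succ l => simp [awayJacobian, hε]
  constructor
  · rintro ⟨φ, hφ⟩
    let ε : Localization.Away F →+* ℂ :=
      φ.toRingHom.comp (Ideal.Quotient.mk (critIdeal F g η))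
    have hε : ∀ p, ε (algebraMap (Poly n) (Localization.Away F) p) = eval x p := by
      have : ε.comp (algebraMap (Poly n) (Localization.Away F)) = eval x := by
        apply MvPolynomial.ringHom_ext
        · intro r
          rw [RingHom.comp_apply, algebraMap_C_eq, eval_C]
          exact φ.commutes r
        · intro j
          rw [eval_X]
          exact hφ j
      exact fun p => RingHom.congr_fun this p
    have hε0 : ∀ z ∈ critIdeal F g η, ε z = 0 := fun z hz => by
      change φ (Ideal.Quotient.mk _ z) = 0
      rw [Ideal.Quotient.eq_zero_iff_mem.mpr hz, map_zero]
    have hg0 : ∀ i, eval x (g i) = 0 := fun i => by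
      rw [← hε]
      exact hε0 _ (Ideal.mem_sup_right (Ideal.mem_map_of_mem _ (Ideal.subset_span ⟨i, rfl⟩)))
    have hF0 : eval x F ≠ 0 := by
      rw [← hε]
      exact ((IsLocalization.Away.algebraMap_isUnit F).map ε).ne_zero
    refine ⟨hg0, hF0, ?_⟩
    obtain ⟨s, t, hst⟩ := exists_minor_ne_zero _ (hrank x hg0 hF0).ge
    refine exists_combination_of_minors ((jacobian g).map (eval x)) _ s t hst
      (fun s t => ?_) fun s t => ?_
    · by_contra h
      have := le_rank_of_minor_ne_zero _ s t h
      rw [hrank x hg0 hF0] at this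
      omega
    · have h1 := hε0 _ (Ideal.mem_sup_left (Ideal.subset_span ⟨(s, t), rfl⟩))
      rw [← hmap ε hε hF0]
      rw [RingHom.map_det] at h1
      exact h1
  · rintro ⟨hg0, hF0, μ, hμ⟩
    let ε : Localization.Away F →+* ℂ :=
      IsLocalization.Away.lift F (g := eval x) (isUnit_iff_ne_zero.mpr hF0)
    have hε : ∀ p, ε (algebraMap (Poly n) (Localization.Away F) p) = eval x p := fun p =>
      IsLocalization.Away.lift_eq F _ p
    have hle : critIdeal F g η ≤ RingHom.ker ε := by
      refine sup_le (Ideal.span_le.mpr ?_) ?_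
      · rintro _ ⟨⟨s, t⟩, rfl⟩
        change ε _ = 0
        rw [RingHom.map_det]
        have h1 := det_consRow_combination ((jacobian g).map (eval x)) μ (r := codim g + 1)
          (fun s t => by
            by_contra h
            have := le_rank_of_minor_ne_zero _ s t h
            rw [hrank x hg0 hF0] at this
            omega) s t
        rw [← h1]
        change (((matrixA F g η).map ε).submatrix s t).det = _
        rw [hmap ε hε hF0, funext hμ]
        rfl
      · rw [Ideal.map_le_iff_le_comap]
        intro p hp
        change ε _ = 0
        rw [hε]
        exact eval_eq_zero_of_mem_idealOf g hg0 hp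
    let ψ : CritRing F g η →+* ℂ := Ideal.Quotient.lift _ ε hle
    refine ⟨{ ψ with commutes' := fun r => ?_ }, fun j => ?_⟩
    · change ψ (Ideal.Quotient.mk _ (algebraMap ℂ (Localization.Away F) r)) = r
      rw [← algebraMap_C_eq]
      exact (Ideal.Quotient.lift_mk _ _ _).trans ((hε _).trans (eval_C r))
    · change ψ (Ideal.Quotient.mk _ _) = _
      exact (Ideal.Quotient.lift_mk _ _ _).trans ((hε _).trans (eval_X j))

theorem eval_linForm (x η : Fin (n + 1) → ℂ) : eval x (linForm η) = ∑ j, η j * x j := by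
  simp [linForm]

theorem linForm_isHomogeneous (η : Fin (n + 1) → ℂ) : (linForm η).IsHomogeneous 1 :=
  IsHomogeneous.sum _ _ _ fun _ _ => isHomogeneous_C_mul_X _ _

theorem pderiv_linForm (η : Fin (n + 1) → ℂ) (j : Fin (n + 1)) :
    pderiv j (linForm η) = C (η j) := by
  classical
  simp only [linForm, map_sum, pderiv_C_mul, pderiv_X]
  rw [Finset.sum_eq_single j]
  · simp
  · intro i _ hi
    simp [hi]
  · simp

/-- The factor `a` on the left avoids the exponent `e - 1`, which is wrong for `e = 0`. -/
theorem eval_pderiv_smul {p : Poly n} {e : ℕ} (hp : p.IsHomogeneous e) (a : ℂ)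
    (x : Fin (n + 1) → ℂ) (j : Fin (n + 1)) :
    a * eval (a • x) (pderiv j p) = a ^ e * eval x (pderiv j p) := by
  rcases e with _ | e
  · rw [← totalDegree_zero_iff_isHomogeneous, totalDegree_eq_zero_iff_eq_C] at hp
    rw [hp, pderiv_C]
    simp
  · rw [eval_smul_of_isHomogeneous hp.pderiv, Nat.add_sub_cancel, pow_succ']
    ring

/-- The condition `IsNormal`, with `η` multiplied by `t`, is invariant under scaling of `x`
and `t`. -/
theorem IsNormal.smul {d : ℕ} (hF : F.IsHomogeneous d)
    (hg : ∀ i, ∃ e : ℕ, (g i).IsHomogeneous e) {x η : Fin (n + 1) → ℂ} {a t : ℂ} (ha : a ≠ 0)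
    (h : IsNormal g F x (t • η)) : IsNormal g F (a • x) ((a⁻¹ * t) • η) := by
  obtain ⟨μ, hμ⟩ := h
  choose e he using hg
  refine ⟨fun l => a⁻¹ * μ l * a * (a ^ e l)⁻¹, fun j => ?_⟩
  have h1 : eval (a • x) (pderiv j F) / eval (a • x) F =
      a⁻¹ * (eval x (pderiv j F) / eval x F) := by
    have h2 := eval_pderiv_smul hF a x j
    have h3 : eval (a • x) (pderiv j F) = a⁻¹ * (a ^ d * eval x (pderiv j F)) := by
      rw [← h2, inv_mul_cancel_left₀ ha]
    rw [h3, eval_smul_of_isHomogeneous hF, mul_div_assoc,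
      mul_div_mul_left _ _ (pow_ne_zero _ ha)]
  have h4 : ∀ l, a⁻¹ * μ l * a * (a ^ e l)⁻¹ * eval (a • x) (pderiv j (g l)) =
      a⁻¹ * (μ l * eval x (pderiv j (g l))) := by
    intro l
    have h2 := eval_pderiv_smul (he l) a x j
    have h5 := pow_ne_zero (e l) ha
    field_simp
    linear_combination (μ l) * h2
  simp only [h4, ← Finset.mul_sum, ← hμ, h1, Pi.smul_apply, smul_eq_mul]
  ring

/-- Euler's relation determines the scale of a critical point on the cone. -/
theorem IsNormal.linForm_eq {d : ℕ} (hF : F.IsHomogeneous d)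
    (hg : ∀ i, ∃ e : ℕ, (g i).IsHomogeneous e) {x η : Fin (n + 1) → ℂ}
    (hg0 : ∀ i, eval x (g i) = 0) (hF0 : eval x F ≠ 0)
    (h : IsNormal g F x η) : eval x (linForm η) = d := by
  obtain ⟨μ, hμ⟩ := h
  have euler : ∀ {p : Poly n} {e : ℕ}, p.IsHomogeneous e →
      ∑ j, x j * eval x (pderiv j p) = e * eval x p := by
    intro p e hp
    have := congrArg (eval x) hp.sum_X_mul_pderiv
    simpa [nsmul_eq_mul] using this
  have h1 : ∑ j, x j * (eval x (pderiv j F) / eval x F - η j) = 0 := by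
    simp only [hμ, Finset.mul_sum]
    rw [Finset.sum_comm]
    refine Finset.sum_eq_zero fun l _ => ?_
    obtain ⟨e, he⟩ := hg l
    have h2 := euler he
    rw [hg0, mul_zero] at h2
    rw [← mul_zero (μ l), ← h2, Finset.mul_sum]
    exact Finset.sum_congr rfl fun j _ => by ring
  simp only [mul_sub, Finset.sum_sub_distrib, ← mul_div_assoc, ← Finset.sum_div, euler hF] at h1
  rw [mul_div_cancel_right₀ _ hF0] at h1
  rw [eval_linForm, sub_eq_zero.mp h1]
  exact Finset.sum_congr rfl fun j _ => mul_comm _ _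

end

/-! ### Differentials of the local rings of the projective variety -/

noncomputable section

variable {n k : ℕ} (g : Fin k → Poly n) [hI : (idealOf g).IsPrime]

theorem coe_mem_localRing {p : projZeros g} (z : localRing g p) :
    ∃ (m : ℕ) (a b : Poly n), a.IsHomogeneous m ∧ b.IsHomogeneous m ∧
      eval p.1.rep b ≠ 0 ∧ (z : ConeField g) = toField g a / toField g b := z.2

/-- A homomorphism from the polynomial ring that kills the ideal of `X` and makes the polynomials
that do not vanish at `p` invertible induces one on the local ring of `X` at `p`. -/
theorem exists_localRing_hom {p : projZeros g} {S : Type*} [CommRing S] [Algebra ℂ S]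
    (e : Poly n →ₐ[ℂ] S) (he : ∀ f ∈ idealOf g, e f = 0)
    (hu : ∀ b : Poly n, eval p.1.rep b ≠ 0 → IsUnit (e b)) :
    ∃ Φ : localRing g p →ₐ[ℂ] S, ∀ (z : localRing g p) (a b : Poly n), toField g b ≠ 0 →
      (z : ConeField g) = toField g a / toField g b → Φ z * e b = e a := by
  have hcross : ∀ {a b a' b' : Poly n}, toField g b ≠ 0 → toField g b' ≠ 0 →
      toField g a / toField g b = toField g a' / toField g b' → e a * e b' = e a' * e b := by
    intro a b a' b' hb hb' h
    rw [div_eq_div_iff hb hb', ← map_mul, ← map_mul, ← sub_eq_zero, ← map_sub,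
      toField_eq_zero_iff] at h
    have := he _ h
    rw [map_sub, map_mul, map_mul, sub_eq_zero] at this
    exact this
  choose m a b ha hb hpb hz using fun z : localRing g p => coe_mem_localRing g z
  have hb0 : ∀ z, toField g (b z) ≠ 0 := fun z => toField_ne_zero g p.2 (hpb z)
  choose w hw using fun z => (hu (b z) (hpb z)).exists_right_inv
  let φ : localRing g p → S := fun z => e (a z) * w z
  -- the value does not depend on the chosen fraction
  have key : ∀ (z : localRing g p) (a' b' : Poly n), toField g b' ≠ 0 →
      (z : ConeField g) = toField g a' / toField g b' → φ z * e b' = e a' := by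
    intro z a' b' hb' hz'
    have h1 := hcross (hb0 z) hb' ((hz z).symm.trans hz')
    simp only [φ]
    linear_combination (w z) * h1 + (e a') * hw z
  have hval : ∀ (z : localRing g p) (a' b' : Poly n) (s : S), eval p.1.rep b' ≠ 0 →
      (z : ConeField g) = toField g a' / toField g b' → s * e b' = e a' → φ z = s := by
    intro z a' b' s hb' hz' hs
    have h1 := key z a' b' (toField_ne_zero g p.2 hb') hz'
    exact (hu b' hb').mul_right_cancel (h1.trans hs.symm)
  refine ⟨{ toFun := φ, map_one' := ?_, map_mul' := ?_, map_zero' := ?_, map_add' := ?_,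
            commutes' := ?_ }, key⟩
  · exact hval _ 1 1 _ (by simp) (by simp) (by simp)
  · intro z z'
    refine hval _ (a z * a z') (b z * b z') _ ?_ ?_ ?_
    · rw [map_mul]; exact mul_ne_zero (hpb z) (hpb z')
    · rw [MulMemClass.coe_mul, map_mul, map_mul, ← div_mul_div_comm, ← hz, ← hz]
    · rw [map_mul, map_mul, ← key z _ _ (hb0 z) (hz z), ← key z' _ _ (hb0 z') (hz z')]
      ring
  · exact hval _ 0 1 _ (by simp) (by simp) (by simp)
  · intro z z'
    refine hval _ (a z * b z' + b z * a z') (b z * b z') _ ?_ ?_ ?_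
    · rw [map_mul]; exact mul_ne_zero (hpb z) (hpb z')
    · rw [AddMemClass.coe_add, map_add, map_mul, map_mul, map_mul,
        ← div_add_div _ _ (hb0 z) (hb0 z'), ← hz, ← hz]
    · rw [map_add, map_mul, map_mul, map_mul, ← key z _ _ (hb0 z) (hz z),
        ← key z' _ _ (hb0 z') (hz z')]
      ring
  · intro r
    refine hval _ (C r) 1 _ (by simp) ?_ ?_
    · rw [map_one, div_one]
      rfl
    · rw [map_one, mul_one]
      exact (e.commutes r).symm

/-- Evaluation of the functions regular at `p`. -/
theorem exists_localRing_eval (p : projZeros g) :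
    ∃ ev : localRing g p →ₐ[ℂ] ℂ, ∀ (z : localRing g p) (a b : Poly n), toField g b ≠ 0 →
      (z : ConeField g) = toField g a / toField g b → ev z * eval p.1.rep b = eval p.1.rep a := by
  obtain ⟨ev, h⟩ := exists_localRing_hom g (p := p) (aeval p.1.rep)
    (fun f hf => eval_eq_zero_of_mem g p.2 hf) (fun b hb => isUnit_iff_ne_zero.mpr hb)
  exact ⟨ev, h⟩

/-- The maximal ideal is the kernel of any homomorphism to the ground field. -/
theorem mem_maximalIdeal_iff_eval {O : Type*} [CommRing O] [IsLocalRing O] [Algebra ℂ O]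
    (ev : O →ₐ[ℂ] ℂ) (z : O) : z ∈ IsLocalRing.maximalIdeal O ↔ ev z = 0 := by
  have hmax : (RingHom.ker ev).IsMaximal :=
    RingHom.ker_isMaximal_of_surjective ev fun r => ⟨algebraMap ℂ O r, ev.commutes r⟩
  rw [← IsLocalRing.eq_maximalIdeal hmax]
  exact RingHom.mem_ker

/-- If `d log u` vanishes at the closed point, then so does the derivative of `u` along any tangent
vector there, given as a homomorphism to the dual numbers. -/
theorem snd_eq_zero_of_dLogVanishes {O : Type*} [CommRing O] [IsLocalRing O] [Algebra ℂ O]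
    (Φ : O →ₐ[ℂ] DualNumber ℂ) (u : Oˣ) (h : DLogVanishes O u) :
    TrivSqZeroExt.snd (Φ u) = 0 := by
  let ev : O →ₐ[ℂ] ℂ := (TrivSqZeroExt.fstHom ℂ ℂ ℂ).comp Φ
  let _ : Module O ℂ := Module.compHom ℂ ev.toRingHom
  have hsmul : ∀ (z : O) (r : ℂ), z • r = ev z * r := fun _ _ => rfl
  have : IsScalarTower ℂ O ℂ := ⟨fun r z t => by
    rw [hsmul, hsmul, map_smul, smul_mul_assoc]⟩
  let D : Derivation ℂ O ℂ := Derivation.mk'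
    ((TrivSqZeroExt.sndHom ℂ ℂ).comp Φ.toLinearMap) fun a b => by
      change TrivSqZeroExt.snd (Φ (a * b)) = _
      rw [map_mul, TrivSqZeroExt.snd_mul, hsmul, hsmul]
      change _ = TrivSqZeroExt.fst (Φ a) * TrivSqZeroExt.snd (Φ b) +
        TrivSqZeroExt.fst (Φ b) * TrivSqZeroExt.snd (Φ a)
      simp [mul_comm]
  have hzero : ∀ ω ∈ IsLocalRing.maximalIdeal O • (⊤ : Submodule O (Ω[O⁄ℂ])),
      D.liftKaehlerDifferential ω = 0 := by
    intro ω hω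
    induction hω using Submodule.smul_induction_on' with
    | smul r hr m _ =>
      rw [map_smul, hsmul, (mem_maximalIdeal_iff_eval ev r).mp hr, zero_mul]
    | add x _ y _ hx hy => rw [map_add, hx, hy, add_zero]
  have h1 := hzero _ h
  rw [map_smul, D.liftKaehlerDifferential_comp_D, hsmul, mul_eq_zero] at h1
  refine h1.resolve_left fun h2 => ?_
  exact ((u⁻¹).isUnit.map ev).ne_zero h2

/-- The first-order expansion of a polynomial at `x` in direction `v`. -/
def jetHom (x v : Fin (n + 1) → ℂ) : Poly n →ₐ[ℂ] DualNumber ℂ :=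
  aeval fun j => TrivSqZeroExt.inl (x j) + TrivSqZeroExt.inr (v j)

theorem jetHom_apply (x v : Fin (n + 1) → ℂ) (p : Poly n) :
    jetHom x v p = TrivSqZeroExt.inl (eval x p) +
      TrivSqZeroExt.inr (∑ j, eval x (pderiv j p) * v j) := by
  have hfst : ∀ p, TrivSqZeroExt.fst (jetHom x v p) = eval x p := by
    intro p
    have : (TrivSqZeroExt.fstHom ℂ ℂ ℂ).comp (jetHom x v) = aeval x := by
      ext j
      simp [jetHom]
    exact AlgHom.congr_fun this p
  induction p using MvPolynomial.induction_on with
  | C a =>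
    simp only [eval_C, pderiv_C, map_zero, zero_mul, Finset.sum_const_zero,
      TrivSqZeroExt.inr_zero, add_zero]
    exact (jetHom x v).commutes a
  | add p q hp hq =>
    rw [map_add, hp, hq]
    ext <;> simp [add_mul, Finset.sum_add_distrib]
  | mul_X p i hp =>
    rw [map_mul, hp]
    have hX : jetHom x v (X i) = TrivSqZeroExt.inl (x i) + TrivSqZeroExt.inr (v i) := by
      simp [jetHom]
    rw [hX]
    have h1 : ∀ j, eval x (pderiv j (p * X i)) * v j =
        x i * (eval x (pderiv j p) * v j) + if j = i then eval x p * v i else 0 := by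
      intro j
      rw [Derivation.leibniz, pderiv_X]
      by_cases hj : j = i
      · subst hj
        simp
        ring
      · simp [hj, Ne.symm hj]
        ring
    simp only [h1, Finset.sum_add_distrib, ← Finset.mul_sum]
    ext
    · simp
    · simp [mul_comm]

/-- Along a tangent vector `v` of the affine cone, the derivative of `log (F / η ^ d)` vanishes
where the differential of the rational function does. -/
theorem isNormal_of_dLogVanishes {d : ℕ} (hd : 0 < d) (F : Poly n) (η : Fin (n + 1) → ℂ)
    (p : projZeros g) (u : (localRing g p)ˣ)
    (hu : ((u : localRing g p) : ConeField g) = ratFun g F d η)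
    (hF : eval p.1.rep F ≠ 0) (hη : eval p.1.rep (linForm η) ≠ 0)
    (h : DLogVanishes (localRing g p) u) :
    IsNormal g F p.1.rep (((d : ℂ) * (eval p.1.rep (linForm η))⁻¹) • η) := by
  set x := p.1.rep with hx
  -- a vector is normal if it annihilates the tangent vectors `v`
  apply exists_combination_of_forall (fun l j => eval x (pderiv j (g l)))
  intro v hv
  have hfst : ∀ q, TrivSqZeroExt.fst (jetHom x v q) = eval x q := fun q => by
    rw [jetHom_apply]; simp
  have hsnd : ∀ q, TrivSqZeroExt.snd (jetHom x v q) = ∑ j, eval x (pderiv j q) * v j := fun q => by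
    rw [jetHom_apply]; simp
  have hker : ∀ f ∈ idealOf g, jetHom x v f = 0 := by
    have : idealOf g ≤ RingHom.ker (jetHom x v) := by
      rw [Ideal.span_le]
      rintro _ ⟨i, rfl⟩
      change jetHom x v (g i) = 0
      rw [jetHom_apply, p.2 i, hv i]
      simp
    exact fun f hf => this hf
  obtain ⟨Φ, hΦ⟩ := exists_localRing_hom g (p := p) (jetHom x v) hker fun b hb => by
    rw [TrivSqZeroExt.isUnit_iff_isUnit_fst, hfst]
    exact isUnit_iff_ne_zero.mpr hb
  have h0 := snd_eq_zero_of_dLogVanishes Φ u h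
  have hη' : toField g (linForm η ^ d) ≠ 0 :=
    toField_ne_zero g p.2 (by rw [map_pow]; exact pow_ne_zero _ hη)
  have h1 := hΦ u _ _ hη' hu
  have h2 := congrArg TrivSqZeroExt.fst h1
  have h3 := congrArg TrivSqZeroExt.snd h1
  rw [TrivSqZeroExt.fst_mul, hfst, hfst, map_mul, eval_C, map_pow] at h2
  rw [TrivSqZeroExt.snd_mul, h0, hfst, hsnd, hsnd] at h3
  have h4 : ∀ j, eval x (pderiv j (linForm η ^ d)) * v j =
      (d * eval x (linForm η) ^ (d - 1)) * (η j * v j) := by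
    intro j
    rw [pderiv_pow, pderiv_linForm]
    simp only [map_mul, map_natCast, map_pow, eval_C]
    ring
  have h5 : ∀ j, eval x (pderiv j (C ((d : ℂ) ^ d) * F)) * v j =
      (d : ℂ) ^ d * (eval x (pderiv j F) * v j) := by
    intro j
    rw [pderiv_C_mul, map_mul, eval_C]
    ring
  simp only [h4, h5, ← Finset.mul_sum] at h3
  simp only [smul_zero, add_zero, smul_eq_mul] at h3
  have h6 : ∀ j, (eval x (pderiv j F) / eval x F -
      (((d : ℂ) * (eval x (linForm η))⁻¹) • η) j) * v j =
      (eval x F)⁻¹ * (eval x (pderiv j F) * v j) -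
        ((d : ℂ) * (eval x (linForm η))⁻¹) * (η j * v j) := by
    intro j
    simp only [Pi.smul_apply, smul_eq_mul]
    ring
  simp only [h6, Finset.sum_sub_distrib, ← Finset.mul_sum]
  set E := eval x (linForm η)
  set r := ∑ j, η j * v j
  set w := ∑ j, eval x (pderiv j F) * v j
  have hdd : (d : ℂ) ^ d ≠ 0 := pow_ne_zero _ (Nat.cast_ne_zero.mpr hd.ne')
  have h7 : E ^ d = E ^ (d - 1) * E := by rw [← pow_succ, Nat.sub_add_cancel hd]
  have h8 : w * E = d * eval x F * r := by
    apply mul_left_cancel₀ hdd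
    linear_combination (-E) * h3 + (d * r) * h2 - (d * r * TrivSqZeroExt.fst (Φ u)) * h7
  field_simp
  linear_combination h8

/-- On a module killed by the maximal ideal, functions act through their values. -/
theorem smul_eq_eval_smul {O M : Type*} [CommRing O] [IsLocalRing O] [Algebra ℂ O]
    [AddCommGroup M] [Module O M] [Module ℂ M] [IsScalarTower ℂ O M] (ev : O →ₐ[ℂ] ℂ) (z : O)
    (m : M ⧸ IsLocalRing.maximalIdeal O • (⊤ : Submodule O M)) :
    z • m = ev z • m := by
  obtain ⟨m, rfl⟩ := Submodule.Quotient.mk_surjective _ m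
  rw [← sub_eq_zero, ← Submodule.Quotient.mk_smul, ← Submodule.Quotient.mk_smul,
    ← Submodule.Quotient.mk_sub, Submodule.Quotient.mk_eq_zero,
    ← algebraMap_smul O (ev z) m, ← sub_smul]
  refine Submodule.smul_mem_smul ?_ trivial
  rw [mem_maximalIdeal_iff_eval ev, map_sub, sub_eq_zero]
  exact (ev.commutes _).symm

/-- Let `y` be a point of the affine cone with values in a local `ℂ`-algebra and `u` a unit with
`u * η(y) ^ d = d ^ d * F(y)`. Modulo the maximal ideal `d log u` is the combination of the `dy j`
with coefficients the entries of `∇F / F - d η / η(x)` at the closed point `x` of `y`, and the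
differentials of the equations of the cone are relations between the `dy j`. -/
theorem dLogVanishes_of_combination {O : Type*} [CommRing O] [IsLocalRing O] [Algebra ℂ O]
    {n k d : ℕ} (hd : 0 < d) (g : Fin k → Poly n) (F : Poly n) (η : Fin (n + 1) → ℂ)
    (ev : O →ₐ[ℂ] ℂ) (u : Oˣ) (y : Fin (n + 1) → O) (x : Fin (n + 1) → ℂ)
    (hx : ∀ j, ev (y j) = x j) (hgy : ∀ l, aeval y (g l) = 0)
    (hmain : (u : O) * aeval y (linForm η ^ d) = aeval y (C ((d : ℂ) ^ d) * F))
    (hFx : eval x F ≠ 0) (hηx : eval x (linForm η) ≠ 0)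
    (hN : IsNormal g F x (((d : ℂ) * (eval x (linForm η))⁻¹) • η)) :
    DLogVanishes O u := by
  have hevy : ∀ q : Poly n, ev (aeval y q) = eval x q := by
    intro q
    have h2 : ev.comp (aeval y) = aeval x := by
      ext j
      simp [hx]
    exact AlgHom.congr_fun h2 q
  let D : Derivation ℂ O (Ω[O⁄ℂ] ⧸ (IsLocalRing.maximalIdeal O • (⊤ : Submodule O (Ω[O⁄ℂ])))) :=
    (Submodule.mkQ _).compDer (KaehlerDifferential.D ℂ O)
  have hsc : ∀ (z : O) (m : Ω[O⁄ℂ] ⧸ (IsLocalRing.maximalIdeal O • (⊤ : Submodule O (Ω[O⁄ℂ])))),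
      z • m = ev z • m := smul_eq_eval_smul ev
  have hDq : ∀ q : Poly n, D (aeval y q) = ∑ j, eval x (pderiv j q) • D (y j) := by
    intro q
    rw [derivation_aeval]
    exact Finset.sum_congr rfl fun j _ => by rw [hsc, hevy]
  obtain ⟨μ, hμ⟩ := hN
  have hrel : ∀ l, ∑ j, eval x (pderiv j (g l)) • D (y j) = 0 := by
    intro l
    rw [← hDq, hgy, map_zero]
  have hDu : D (u : O) = 0 := by
    have h1 := congrArg D hmain
    have h2 := congrArg ev hmain
    rw [map_mul, hevy, hevy, map_mul, eval_C, map_pow] at h2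
    rw [Derivation.leibniz, hDq, hDq, hsc, hsc (aeval y _), hevy, map_pow] at h1
    have h7 : eval x (linForm η) ^ d = eval x (linForm η) ^ (d - 1) * eval x (linForm η) := by
      rw [← pow_succ, Nat.sub_add_cancel hd]
    have hcoef : ∀ j, eval x (pderiv j (C ((d : ℂ) ^ d) * F)) =
        ev u * eval x (pderiv j (linForm η ^ d)) +
          (d : ℂ) ^ d * eval x F * ∑ l, μ l * eval x (pderiv j (g l)) := by
      intro j
      rw [← hμ j, pderiv_C_mul, pderiv_pow, pderiv_linForm]
      simp only [map_mul, map_natCast, map_pow, eval_C, Pi.smul_apply, smul_eq_mul]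
      rw [h7] at h2
      field_simp
      linear_combination (-(d : ℂ) * η j) * h2
    have h3 : ∑ j, (∑ l, μ l * eval x (pderiv j (g l))) • D (y j) = 0 := by
      simp only [Finset.sum_smul, mul_smul]
      rw [Finset.sum_comm]
      exact Finset.sum_eq_zero fun l _ => by rw [← Finset.smul_sum, hrel, smul_zero]
    simp only [hcoef, add_smul, Finset.sum_add_distrib, mul_smul, ← Finset.smul_sum] at h1
    rw [h3, smul_zero, smul_zero, add_zero, add_eq_left] at h1
    exact (smul_eq_zero.mp h1).resolve_left (pow_ne_zero _ hηx)
  have h3 : KaehlerDifferential.D ℂ O (u : O) ∈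
      IsLocalRing.maximalIdeal O • (⊤ : Submodule O (Ω[O⁄ℂ])) := by
    rw [← Submodule.Quotient.mk_eq_zero]
    exact hDu
  exact Submodule.smul_mem _ _ h3

/-- Conversely, the differential of the rational function is computed from the affine coordinates
`x j / x i` at `p`, for some `i`. -/
theorem dLogVanishes_of_isNormal {d : ℕ} (hd : 0 < d) {F : Poly n} (hF : F.IsHomogeneous d)
    (hg : ∀ i, ∃ e : ℕ, (g i).IsHomogeneous e) (η : Fin (n + 1) → ℂ)
    (p : projZeros g) (u : (localRing g p)ˣ)
    (hu : ((u : localRing g p) : ConeField g) = ratFun g F d η)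
    (hFp : eval p.1.rep F ≠ 0) (hη : eval p.1.rep (linForm η) ≠ 0)
    (h : IsNormal g F p.1.rep (((d : ℂ) * (eval p.1.rep (linForm η))⁻¹) • η)) :
    DLogVanishes (localRing g p) u := by
  obtain ⟨i, hi⟩ : ∃ i, p.1.rep i ≠ 0 := Function.ne_iff.mp p.1.rep_nonzero
  have hXi : toField g (X i) ≠ 0 := toField_ne_zero g p.2 (by rwa [eval_X])
  obtain ⟨ev, hev⟩ := exists_localRing_eval g p
  let y : Fin (n + 1) → localRing g p := fun j =>
    ⟨toField g (X j) / toField g (X i), 1, X j, X i, isHomogeneous_X _ _, isHomogeneous_X _ _,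
      by rwa [eval_X], rfl⟩
  set x : Fin (n + 1) → ℂ := (p.1.rep i)⁻¹ • p.1.rep with hx
  have hevy : ∀ j, ev (y j) = x j := by
    intro j
    have := hev (y j) (X j) (X i) hXi rfl
    rw [eval_X, eval_X] at this
    rw [hx, Pi.smul_apply, smul_eq_mul, ← this]
    field_simp
  have hcoe : ∀ {q : Poly n} {m : ℕ}, q.IsHomogeneous m →
      ((aeval y q : localRing g p) : ConeField g) = ((toField g (X i))⁻¹) ^ m * toField g q := by
    intro q m hq
    rw [← aeval_toField_X g q, ← aeval_smul_of_isHomogeneous hq]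
    have h1 := (aeval_algebraMap_apply (ConeField g) y q).symm
    refine Eq.trans h1 ?_
    congr 2
    funext j
    change toField g (X j) / toField g (X i) = (toField g (X i))⁻¹ * toField g (X j)
    rw [div_eq_inv_mul]
  -- the equation `u * η ^ d = d ^ d * F` in the local ring
  have hη' : toField g (linForm η) ≠ 0 := toField_ne_zero g p.2 hη
  have hmain : (u : localRing g p) * aeval y (linForm η ^ d) =
      aeval y (C ((d : ℂ) ^ d) * F) := by
    apply Subtype.ext
    have h1 : (linForm η ^ d).IsHomogeneous d := by
      simpa using (linForm_isHomogeneous η).pow d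
    rw [MulMemClass.coe_mul, hcoe h1, hcoe (hF.C_mul _), hu, ratFun]
    rw [map_pow]
    field_simp
  have hx0 : (p.1.rep i)⁻¹ ≠ 0 := inv_ne_zero hi
  have hFx : eval x F ≠ 0 := by
    rw [hx, eval_smul_of_isHomogeneous hF]
    exact mul_ne_zero (pow_ne_zero _ hx0) hFp
  have hηx : eval x (linForm η) = (p.1.rep i)⁻¹ * eval p.1.rep (linForm η) := by
    rw [hx, eval_smul_of_isHomogeneous (linForm_isHomogeneous η), pow_one]
  have hηx0 : eval x (linForm η) ≠ 0 := by rw [hηx]; exact mul_ne_zero hx0 hη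
  have hN : IsNormal g F x (((d : ℂ) * (eval x (linForm η))⁻¹) • η) := by
    have := IsNormal.smul g F hF hg hx0 h
    rw [hηx]
    convert this using 2
    rw [mul_inv]
    ring
  refine dLogVanishes_of_combination hd g F η ev u y x hevy (fun l => ?_) hmain hFx hηx0 hN
  obtain ⟨e, he⟩ := hg l
  apply Subtype.ext
  rw [hcoe he, (toField_eq_zero_iff g).mpr (Ideal.subset_span ⟨l, rfl⟩), mul_zero]
  rfl

end

/-! ### Comparison of the two sets of critical points -/

noncomputable section

theorem Generic.and {n : ℕ} {P Q : (Fin (n + 1) → ℂ) → Prop} (hP : Generic P) (hQ : Generic Q) :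
    Generic fun η => P η ∧ Q η := by
  obtain ⟨h, h0, H⟩ := hP
  obtain ⟨h', h0', H'⟩ := hQ
  refine ⟨h * h', mul_ne_zero h0 h0', fun η hη => ?_⟩
  rw [map_mul] at hη
  exact ⟨H η (left_ne_zero_of_mul hη), H' η (right_ne_zero_of_mul hη)⟩

theorem Generic.exists {n : ℕ} {P : (Fin (n + 1) → ℂ) → Prop} (hP : Generic P) : ∃ η, P η := by
  obtain ⟨h, h0, H⟩ := hP
  by_contra! hne
  refine h0 (MvPolynomial.funext fun η => ?_)
  rw [map_zero]
  by_contra hη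
  exact hne η (H η hη)

theorem Generic.forall_finset {n : ℕ} {ι : Type*} (s : Finset ι)
    {P : ι → (Fin (n + 1) → ℂ) → Prop} (hP : ∀ i ∈ s, Generic (P i)) :
    Generic fun η => ∀ i ∈ s, P i η := by
  classical
  induction s using Finset.induction_on with
  | empty => exact ⟨1, one_ne_zero, by simp⟩
  | insert a s _ ih =>
    obtain ⟨h, h0, H⟩ := (hP a (Finset.mem_insert_self a s)).and
      (ih fun i hi => hP i (Finset.mem_insert_of_mem hi))
    refine ⟨h, h0, fun η hη i hi => ?_⟩
    rcases Finset.mem_insert.mp hi with rfl | hi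
    · exact (H η hη).1
    · exact (H η hη).2 i hi

/-- The number of critical points for generic `η` is unique, as two generic conditions are satisfied
simultaneously. -/
theorem mlDegree_eq {n k : ℕ} (F : Poly n) (g : Fin k → Poly n) {N : ℕ}
    (h : Generic fun η => (coneCritPoints F g η).encard = N) : mlDegree F g = N := by
  have hset : {N : ℕ | Generic fun η => (coneCritPoints F g η).encard = N} = {N} := by
    ext M
    refine ⟨fun hM => ?_, fun hM => hM ▸ h⟩
    obtain ⟨η, h1, h2⟩ := Generic.exists (Generic.and hM h)
    exact_mod_cast h1.symm.trans h2
  rw [mlDegree, hset, csInf_singleton]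

/-- A generic hyperplane through the origin contains no irreducible component of a given closed
set, other than the origin. -/
theorem generic_linForm_notMem {n : ℕ} (I : Ideal (Poly n)) :
    Generic fun η : Fin (n + 1) → ℂ =>
      ∀ P ∈ I.minimalPrimes, (∃ j, (X j : Poly n) ∉ P) → linForm η ∉ P := by
  have hfin := I.finite_minimalPrimes_of_isNoetherianRing
  have key := Generic.forall_finset (n := n) hfin.toFinset
    (P := fun P η => (∃ j, (X j : Poly n) ∉ P) → linForm η ∉ P) fun P hP => by
      have hprime : P.IsPrime := ((hfin.mem_toFinset).mp hP).1.1
      by_cases hX : ∃ j, (X j : Poly n) ∉ P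
      · obtain ⟨j, hj⟩ := hX
        -- by the Nullstellensatz some zero `v` of `P` has `v j ≠ 0`
        rw [← MvPolynomial.IsPrime.vanishingIdeal_zeroLocus (K := ℂ) P,
          mem_vanishingIdeal_iff] at hj
        push Not at hj
        obtain ⟨v, hv, hvj⟩ := hj
        rw [aeval_X] at hvj
        refine ⟨linForm v, fun h0 => hvj ?_, fun η hη _ hmem => hη ?_⟩
        · have := pderiv_linForm v j
          rw [h0, map_zero] at this
          exact (C_eq_zero.mp this.symm)
        · have h1 := mem_zeroLocus_iff.mp hv _ hmem
          change eval v (linForm η) = 0 at h1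
          rw [eval_linForm] at h1
          rw [eval_linForm, ← h1]
          exact Finset.sum_congr rfl fun i _ => mul_comm _ _
      · exact ⟨1, one_ne_zero, fun η _ h => absurd h hX⟩
  obtain ⟨h, h0, H⟩ := key
  exact ⟨h, h0, fun η hη P hP => H η hη P (hfin.mem_toFinset.mpr hP)⟩

variable {n k : ℕ} (g : Fin k → Poly n) [hI : (idealOf g).IsPrime]

/-- If `η` vanishes identically on no component of `X ∩ V(F)`, then no cancellation between `F` and
`η ^ d` can occur in the local rings of `X`: the rational function `d ^ d * F / η ^ d` is a unit
only where neither `F` nor `η` vanishes. -/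
theorem eval_ne_zero_of_unit {d : ℕ} (hd : 0 < d) (F : Poly n) (η : Fin (n + 1) → ℂ)
    (hη : ∀ P ∈ (idealOf g ⊔ Ideal.span {F}).minimalPrimes,
      (∃ j, (X j : Poly n) ∉ P) → linForm η ∉ P)
    (p : projZeros g) (u : (localRing g p)ˣ)
    (hu : ((u : localRing g p) : ConeField g) = ratFun g F d η) :
    eval p.1.rep F ≠ 0 ∧ eval p.1.rep (linForm η) ≠ 0 := by
  obtain ⟨ev, hev⟩ := exists_localRing_eval g p
  have hu0 : ev u ≠ 0 := (u.isUnit.map ev).ne_zero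
  have hdd : (d : ℂ) ^ d ≠ 0 := pow_ne_zero _ (Nat.cast_ne_zero.mpr hd.ne')
  have hL : toField g (linForm η ^ d) ≠ 0 := by
    intro h0
    refine hu0 ?_
    have h1 : (u : localRing g p) = 0 := by
      apply Subtype.ext
      rw [hu, ratFun, h0, div_zero]
      rfl
    rw [h1, map_zero]
  have h1 := hev u _ _ hL hu
  rw [map_mul, eval_C, map_pow] at h1
  -- if `F(p) = η(p) = 0` and the quotient is the unit `a / b`, then `a η ^ d` lies in every prime
  -- over `I(X) + (F)`, and `η` in those which vanish at `p`
  by_cases hηp : eval p.1.rep (linForm η) = 0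
  · exfalso
    rw [hηp, zero_pow hd.ne', mul_zero, eq_comm, mul_eq_zero] at h1
    have hFp := h1.resolve_left hdd
    obtain ⟨m, a, b, -, -, hpb, hz⟩ := coe_mem_localRing g (u : localRing g p)
    have hb0 : toField g b ≠ 0 := toField_ne_zero g p.2 hpb
    have hpa : eval p.1.rep a ≠ 0 := by
      rw [← hev u a b hb0 hz]
      exact mul_ne_zero hu0 hpb
    have hmem : C ((d : ℂ) ^ d) * F * b - a * linForm η ^ d ∈ idealOf g := by
      rw [← toField_eq_zero_iff, map_sub, map_mul _ _ b, map_mul _ a, sub_eq_zero]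
      rw [hu, ratFun, div_eq_div_iff hL hb0] at hz
      exact hz
    let 𝔪 : Ideal (Poly n) := RingHom.ker (eval p.1.rep)
    have : 𝔪.IsPrime := RingHom.ker_isPrime _
    have hle : idealOf g ⊔ Ideal.span {F} ≤ 𝔪 := by
      refine sup_le (fun f hf => eval_eq_zero_of_mem g p.2 hf) ?_
      rw [Ideal.span_singleton_le_iff_mem]
      exact hFp
    obtain ⟨P, hP, hPm⟩ := Ideal.exists_minimalPrimes_le hle
    have hPprime : P.IsPrime := hP.1.1
    obtain ⟨j, hj⟩ : ∃ j, p.1.rep j ≠ 0 := Function.ne_iff.mp p.1.rep_nonzero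
    refine hη P hP ⟨j, fun h => hj ?_⟩ ?_
    · have : eval p.1.rep (X j) = 0 := hPm h
      rwa [eval_X] at this
    · have hFP : F ∈ P := hP.1.2 (Ideal.mem_sup_right (Ideal.mem_span_singleton_self F))
      have h2 : a * linForm η ^ d ∈ P := by
        have h3 := P.sub_mem (P.mul_mem_right b (P.mul_mem_left (C ((d : ℂ) ^ d)) hFP))
          (hP.1.2 (Ideal.mem_sup_left hmem))
        rwa [sub_sub_cancel] at h3
      exact hPprime.mem_of_pow_mem d ((hPprime.mem_or_mem h2).resolve_left fun h => hpa (hPm h))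
  · refine ⟨fun hFp => ?_, hηp⟩
    rw [hFp, mul_zero] at h1
    exact mul_ne_zero hu0 (pow_ne_zero _ hηp) h1

/-- The critical points on `X`, for an `η` as in `eval_ne_zero_of_unit`, in terms of a representative
in the cone. -/
theorem mem_logCritPoints_iff {d : ℕ} (hd : 0 < d) {F : Poly n} (hF : F.IsHomogeneous d)
    (hg : ∀ i, ∃ e : ℕ, (g i).IsHomogeneous e) (η : Fin (n + 1) → ℂ)
    (hη : ∀ P ∈ (idealOf g ⊔ Ideal.span {F}).minimalPrimes,
      (∃ j, (X j : Poly n) ∉ P) → linForm η ∉ P) (p : projZeros g) :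
    p ∈ logCritPoints g (ratFun g F d η) ↔
      eval p.1.rep F ≠ 0 ∧ eval p.1.rep (linForm η) ≠ 0 ∧
        IsNormal g F p.1.rep (((d : ℂ) * (eval p.1.rep (linForm η))⁻¹) • η) := by
  constructor
  · rintro ⟨u, hu, -, h⟩
    obtain ⟨h1, h2⟩ := eval_ne_zero_of_unit g hd F η hη p u hu
    exact ⟨h1, h2, isNormal_of_dLogVanishes g hd F η p u hu h1 h2 h⟩
  · rintro ⟨h1, h2, h3⟩
    have hdd : (d : ℂ) ^ d ≠ 0 := pow_ne_zero _ (Nat.cast_ne_zero.mpr hd.ne')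
    have ha : (C ((d : ℂ) ^ d) * F).IsHomogeneous d := hF.C_mul _
    have hb : (linForm η ^ d).IsHomogeneous d := by simpa using (linForm_isHomogeneous η).pow d
    have hpa : eval p.1.rep (C ((d : ℂ) ^ d) * F) ≠ 0 := by
      rw [map_mul, eval_C]
      exact mul_ne_zero hdd h1
    have hpb : eval p.1.rep (linForm η ^ d) ≠ 0 := by
      rw [map_pow]
      exact pow_ne_zero _ h2
    obtain ⟨u, hu⟩ := isUnit_localRing g (z := ⟨_, d, _, _, ha, hb, hpb, rfl⟩) ha hb hpa hpb rfl
    have hu' : ((u : localRing g p) : ConeField g) = ratFun g F d η := congrArg Subtype.val hu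
    exact ⟨u, hu', not_not.mpr ⟨u, hu'⟩, dLogVanishes_of_isNormal g hd hF hg η p u hu' h1 h2 h3⟩

/-- By Euler's formula a critical point on the cone satisfies `η(x) = d`, so each line through the
origin carries at most one, and it carries one exactly if it is a critical point on `X`. -/
theorem encard_logCritPoints_eq {d : ℕ} (hd : 0 < d) {F : Poly n} (hF : F.IsHomogeneous d)
    (hg : ∀ i, ∃ e : ℕ, (g i).IsHomogeneous e)
    (hrank : ∀ x : Fin (n + 1) → ℂ, (∀ i, eval x (g i) = 0) → eval x F ≠ 0 →
      ((jacobian g).map (eval x)).rank = codim g) (η : Fin (n + 1) → ℂ)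
    (hη : ∀ P ∈ (idealOf g ⊔ Ideal.span {F}).minimalPrimes,
      (∃ j, (X j : Poly n) ∉ P) → linForm η ∉ P) :
    (logCritPoints g (ratFun g F d η)).encard = (coneCritPoints F g η).encard := by
  have hd0 : (d : ℂ) ≠ 0 := Nat.cast_ne_zero.mpr hd.ne'
  have hL : ∀ (a : ℂ) (x : Fin (n + 1) → ℂ),
      eval (a • x) (linForm η) = a * eval x (linForm η) := fun a x => by
    rw [eval_smul_of_isHomogeneous (linForm_isHomogeneous η), pow_one]
  -- each critical point on `X` is sent to its representative with `η(x) = d`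
  let r : projZeros g → (Fin (n + 1) → ℂ) := fun p =>
    ((d : ℂ) * (eval p.1.rep (linForm η))⁻¹) • p.1.rep
  have hinj : Set.InjOn r (logCritPoints g (ratFun g F d η)) := by
    intro p hp q hq hpq
    obtain ⟨-, hp2, -⟩ := (mem_logCritPoints_iff g hd hF hg η hη p).mp hp
    obtain ⟨-, hq2, -⟩ := (mem_logCritPoints_iff g hd hF hg η hη q).mp hq
    apply Subtype.ext
    rw [← p.1.mk_rep, ← q.1.mk_rep, Projectivization.mk_eq_mk_iff']
    refine ⟨((d : ℂ) * (eval p.1.rep (linForm η))⁻¹)⁻¹ *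
      ((d : ℂ) * (eval q.1.rep (linForm η))⁻¹), ?_⟩
    rw [mul_smul]
    change _ • r q = _
    rw [← hpq]
    exact inv_smul_smul₀ (mul_ne_zero hd0 (inv_ne_zero hp2)) _
  rw [← hinj.encard_image]
  congr 1
  ext x
  rw [mem_coneCritPoints_iff g F hrank]
  constructor
  · rintro ⟨p, hp, rfl⟩
    obtain ⟨h1, h2, h3⟩ := (mem_logCritPoints_iff g hd hF hg η hη p).mp hp
    have ha : (d : ℂ) * (eval p.1.rep (linForm η))⁻¹ ≠ 0 := mul_ne_zero hd0 (inv_ne_zero h2)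
    refine ⟨fun i => ?_, ?_, ?_⟩
    · obtain ⟨e, he⟩ := hg i
      rw [eval_smul_of_isHomogeneous he, p.2 i, mul_zero]
    · rw [eval_smul_of_isHomogeneous hF]
      exact mul_ne_zero (pow_ne_zero _ ha) h1
    · have := IsNormal.smul g F hF hg ha h3
      rwa [inv_mul_cancel₀ ha, one_smul] at this
  · rintro ⟨h1, h2, h3⟩
    have hηx := IsNormal.linForm_eq g F hF hg h1 h2 h3
    have hx0 : x ≠ 0 := by
      rintro rfl
      have := hL 0 0
      rw [zero_smul, zero_mul, hηx] at this
      exact hd0 this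
    obtain ⟨a, ha⟩ := Projectivization.exists_smul_eq_mk_rep ℂ x hx0
    have ha' : (Projectivization.mk ℂ x hx0).rep = (a : ℂ) • x := ha.symm
    have ha0 : (a : ℂ) ≠ 0 := a.ne_zero
    let p : projZeros g := ⟨Projectivization.mk ℂ x hx0, fun i => by
      obtain ⟨e, he⟩ := hg i
      rw [ha', eval_smul_of_isHomogeneous he, h1, mul_zero]⟩
    have hp : p.1.rep = (a : ℂ) • x := ha'
    have hs : (d : ℂ) * (eval p.1.rep (linForm η))⁻¹ = (a : ℂ)⁻¹ := by
      rw [hp, hL, hηx]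
      field_simp
    refine ⟨p, (mem_logCritPoints_iff g hd hF hg η hη p).mpr ⟨?_, ?_, ?_⟩, ?_⟩
    · rw [hp, eval_smul_of_isHomogeneous hF]
      exact mul_ne_zero (pow_ne_zero _ ha0) h2
    · rw [hp, hL, hηx]
      exact mul_ne_zero ha0 hd0
    · rw [hs, hp, ← mul_one (a : ℂ)⁻¹]
      exact IsNormal.smul g F hF hg ha0 (by rwa [one_smul])
    · change ((d : ℂ) * (eval p.1.rep (linForm η))⁻¹) • p.1.rep = x
      rw [hs, hp]
      exact inv_smul_smul₀ ha0 x

end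

end MLDeg


theorem mainTheorem2 {n k d : ℕ} (hd : 0 < d)
    (F : MLDeg.Poly n) (hF : F.IsHomogeneous d)
    (g : Fin k → MLDeg.Poly n) (hg : ∀ i, ∃ e : ℕ, (g i).IsHomogeneous e)
    [hprime : (MLDeg.idealOf g).IsPrime] (hne : (MLDeg.projZeros g).Nonempty)
    (hsmooth : ∀ p ∈ MLDeg.projZeros g, eval p.rep F ≠ 0 → MLDeg.IsSmoothAt g p) :
    MLDeg.Generic fun η : Fin (n + 1) → ℂ =>
      IsReduced (MLDeg.CritRing F g η) ∧
      (MLDeg.coneCritPoints F g η).encard = MLDeg.mlDegree F g ∧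
      (MLDeg.logCritPoints g (MLDeg.ratFun g F d η)).encard = MLDeg.mlDegree F g := by
  have hrank : ∀ x : Fin (n + 1) → ℂ, (∀ i, eval x (g i) = 0) → eval x F ≠ 0 →
      ((MLDeg.jacobian g).map (eval x)).rank = MLDeg.codim g := fun x hx hFx =>
    MLDeg.rank_jacobian_eval g F hd hF hg hsmooth hx hFx
  obtain ⟨N, hN⟩ := MLDeg.exists_generic_card g F hrank
  have hdeg : MLDeg.mlDegree F g = N := by
    obtain ⟨h, h0, H⟩ := hN
    exact MLDeg.mlDegree_eq F g ⟨h, h0, fun η hη => (H η hη).2⟩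
  obtain ⟨h, h0, H⟩ := hN.and (MLDeg.generic_linForm_notMem (MLDeg.idealOf g ⊔ Ideal.span {F}))
  refine ⟨h, h0, fun η hη => ?_⟩
  obtain ⟨⟨h1, h2⟩, h3⟩ := H η hη
  rw [hdeg]
  exact ⟨h1, h2, (MLDeg.encard_logCritPoints_eq g hd hF hg hrank η h3).trans h2⟩
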